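/- Let $d\ge 1$ and $h\geq 1$ be integers, $0=m_0<m_1<\dots<m_h=M$ real numbers, and for $j=0,\dots,h$ let $p_{m_j}\in C^\infty(\mathbb{R}^d\setminus\{0\};\mathbb{C})$ be positively homogeneous of degree $m_j$, i.e. $p_{m_j}(t\xi)=t^{m_j}p_{m_j}(\xi)$ for $t>0$, $\xi\neq0$. Write $\langle x\rangle=(1+|x|^2)^{1/2}$. Let $p(\xi)=\sum_{j=0}^h p_{m_j}(\xi)$ and assume that for some $c>0$ $$|p(\xi)|\ge c\,\langle\xi\rangle^M,\qquad \xi\in\mathbb{R}^d,\ \xi\ne0.$$ Let $r>0$, $v_r(x)=\langle x\rangle^r$ and $$w_r(x)=\min\Big\{\frac{\langle x\rangle^r}{\log(1+\langle x\rangle)},\ \langle x\rangle^d\Big\}.$$ For a weight $w>0$ let $L^\infty_w=\{u\in L^\infty(\mathbb{R}^d;\mathbb{C}):\ \|u\|_{L^\infty_w}:=\|wu\|_{L^\infty}<\infty\}$. Then the Fourier multiplier with symbol $1/p$ is a well-defined continuous linear operator $$p(D)^{-1}=p^{-1}(D):\ L^\infty_{v_r}\to L^\infty_{w_r}.$$ That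 is, there is a linear map $T:L^\infty_{v_r}\to L^\infty_{w_r}$, and a constant $C$ with $\|Tf\|_{L^\infty_{w_r}}\le C\|f\|_{L^\infty_{v_r}}$ for all $f\in L^\infty_{v_r}$, such that $Tf=p^{-1}(D)f$ in the sense of tempered distributions for every $f\in L^\infty_{v_r}$: for every Schwartz function $\varphi$, $$\int_{\mathbb{R}^d} (Tf)(x)\,\varphi(x)\,dx=\int_{\mathbb{R}^d} f(x)\,\Big((2\pi)^{-d}\int_{\mathbb{R}^d} e^{ix\cdot\xi}\,\frac{\widehat\varphi(\xi)}{p(-\xi)}\,d\xi\Big)dx,\qquad \widehat\varphi(\xi)=\int_{\mathbb{R}^d} e^{-ix\cdot\xi}\varphi(x)\,dx,$$ where both outer integrals converge absolutely. -/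

import Mathlib

open MeasureTheory

noncomputable section

namespace WeightedMultiplier

/-- The space `ℝ^d` with its Euclidean norm and inner product. -/
abbrev Space (d : ℕ) : Type := EuclideanSpace ℝ (Fin d)

/-- The bracket `⟨x⟩ = (1 + |x|²)^{1/2}`. -/
def bracket {d : ℕ} (x : Space d) : ℝ := Real.sqrt (1 + ‖x‖ ^ 2)

/-- The weight `v_r(x) = ⟨x⟩^r`. -/
def weightV (d : ℕ) (r : ℝ) (x : Space d) : ℝ := bracket x ^ r

/-- The weight `w_r(x) = min {⟨x⟩^r / log (1 + ⟨x⟩), ⟨x⟩^d}`. -/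
def weightW (d : ℕ) (r : ℝ) (x : Space d) : ℝ :=
  min (bracket x ^ r / Real.log (1 + bracket x)) (bracket x ^ d)

/-- The weighted Lebesgue space `L^∞_w = {u ∈ L^∞(ℝ^d) : w u ∈ L^∞(ℝ^d)}` of complex-valued
functions modulo equality almost everywhere. -/
def LinfWeighted {d : ℕ} (w : Space d → ℝ) :
    Submodule ℂ (Lp ℂ ⊤ (volume : Measure (Space d))) where
  carrier := {u | MemLp (fun x => (w x : ℂ) * u x) ⊤ volume}
  zero_mem' := by
    refine (memLp_congr_ae ?_).mpr (MemLp.zero (p := ⊤) (μ := (volume : Measure (Space d))))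
    filter_upwards [Lp.coeFn_zero ℂ ⊤ (volume : Measure (Space d))] with x hx
    simp
  add_mem' := by
    intro u v hu hv
    refine (memLp_congr_ae ?_).mpr (MemLp.add hu hv)
    filter_upwards [Lp.coeFn_add u v] with x hx
    rw [Pi.add_apply, hx, Pi.add_apply, mul_add]
  smul_mem' := by
    intro c u hu
    refine (memLp_congr_ae ?_).mpr (MemLp.const_smul hu c)
    filter_upwards [Lp.coeFn_smul c u] with x hx
    simp only [hx, Pi.smul_apply, smul_eq_mul]
    ring

/-- The norm `‖u‖_{L^∞_w} = ‖w u‖_{L^∞}`. -/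
def weightedNorm {d : ℕ} (w : Space d → ℝ) (u : Lp ℂ ⊤ (volume : Measure (Space d))) : ℝ :=
  (eLpNorm (fun x => (w x : ℂ) * u x) ⊤ volume).toReal

/-- The Fourier transform `f̂(ξ) = ∫ e^{-i x·ξ} f(x) dx`. -/
def fourierTransform {d : ℕ} (f : Space d → ℂ) (ξ : Space d) : ℂ :=
  ∫ x, Complex.exp (-(Complex.I * ((inner ℝ x ξ : ℝ) : ℂ))) * f x

/-- The Fourier multiplier `q(D) φ (x) = (2π)^{-d} ∫ e^{i x·ξ} q(ξ) φ̂(ξ) dξ`,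
used for Schwartz functions `φ`. -/
def multiplier {d : ℕ} (q : Space d → ℂ) (φ : Space d → ℂ) (x : Space d) : ℂ :=
  (((2 * Real.pi) ^ d : ℝ) : ℂ)⁻¹ *
    ∫ ξ, Complex.exp (Complex.I * ((inner ℝ x ξ : ℝ) : ℂ)) * q ξ * fourierTransform φ ξ

/-- `u = q(D) f` in the sense of tempered distributions, for functions `f` and `u` on `ℝ^d`:
`∫ u φ = ∫ f (ᵗq(D) φ)` for all Schwartz functions `φ`, both integrals converging absolutely.
Here `ᵗq(D)`, the transpose of `q(D)`, is the Fourier multiplier with symbol `q(-ξ)`; equivalently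
`ᵗq(D) φ (x) = ⟨K, φ(x + ·)⟩` with `K` the inverse Fourier transform of `q`, so that this relation
is the distributional definition of the convolution `u = K * f`. -/
def IsMultiplierImage {d : ℕ} (q : Space d → ℂ) (f u : Space d → ℂ) : Prop :=
  ∀ φ : SchwartzMap (Space d) ℂ,
    Integrable (fun x => u x * φ x) ∧
    Integrable (fun x => f x * multiplier (fun ξ => q (-ξ)) φ x) ∧
    ∫ x, u x * φ x = ∫ x, f x * multiplier (fun ξ => q (-ξ)) φ x

end WeightedMultiplier

end

namespace WeightedMultiplier

/-! Cut `1/p` into dyadic frequency blocks. At frequency `ρ`, homogeneity writes `p(ρη) / max(1,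
ρ^M)` as a combination of the `P j` with coefficients in `[0, 1]`, and ellipticity bounds it below
on the annulus. The rescaled block is therefore bounded in `C^N` by a multiple of `min(1, ρ^{-M})`,
uniformly in `ρ` (`exists_symbol_bound`). Integrating by parts and scaling back, its kernel is at
most a multiple of `min(1, ρ^{-M}) ρ^d (1 + ρ|z|)^{-N}`.

Low frequencies sum pointwise to `(1 + |z|)^{-d}`. No better decay is available in general, since
`1/p` is bounded but need not be continuous at the origin. High frequencies may sum to a singularity
at `z = 0`, but their integrals against the weight `(1 + |x|)^{-r}` sum geometrically because `M >
0`.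

The estimate thus reduces to the convolution of `(1 + |x|)^{-d}` and `(1 + |x|)^{-r}`
(`lintegral_convolution_le`). The first factor just fails to be integrable, which produces the
logarithm; its own decay produces the term `⟨y⟩^{-d}`. Together these are comparable to `1 / w_r`.

The identity with `p^{-1}(D)` holds for partial sums, whose symbols are integrable, by Fubini. It
passes to the limit by dominated convergence on both the frequency side and the kernel side. -/

/-! ### Convolution of the radial powers of exponents `-d` and `-r` -/

lemma lintegral_comp_norm {d : ℕ} (hd : 1 ≤ d) :
    ∃ C : ℝ, 0 ≤ C ∧ ∀ g : ℝ → ℝ, (∀ y, 0 ≤ g y) →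
      IntegrableOn (fun y => y ^ (d - 1) * g y) (Set.Ioi 0) →
      ∫⁻ z : Space d, ENNReal.ofReal (g ‖z‖) =
        ENNReal.ofReal (C * ∫ y in Set.Ioi (0 : ℝ), y ^ (d - 1) * g y) := by
  have : Nonempty (Fin d) := ⟨⟨0, hd⟩⟩
  refine ⟨d * volume.real (Metric.ball (0 : Space d) 1), by positivity, fun g hg hi => ?_⟩
  have hint : Integrable (fun z : Space d => g ‖z‖) := by
    rw [integrable_fun_norm_addHaar]
    simpa using hi
  rw [← ofReal_integral_eq_lintegral_ofReal hint (Filter.Eventually.of_forall fun z => hg _),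
    integral_fun_norm_addHaar]
  simp [mul_assoc]

lemma setLIntegral_sub_left {d : ℕ} (F : Space d → ENNReal) {S : Set (Space d)}
    (hS : MeasurableSet S) (y : Space d) :
    ∫⁻ x in {x | y - x ∈ S}, F (y - x) = ∫⁻ x in S, F x := by
  have hm : MeasurableSet {x | y - x ∈ S} := (measurable_const.sub measurable_id) hS
  rw [← lintegral_indicator hS, ← lintegral_indicator hm]
  exact lintegral_sub_left_eq_self (S.indicator F) y

/-- In polar coordinates `y^{d-1} (1+y)^{-d} ≤ (1+y)^{-1}`, whose integral over `[0, R]` is the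
logarithm. -/
lemma setLIntegral_closedBall_log {d : ℕ} (hd : 1 ≤ d) :
    ∃ C : ℝ, 0 ≤ C ∧ ∀ R : ℝ, 0 ≤ R →
      ∫⁻ z in Metric.closedBall (0 : Space d) R, ENNReal.ofReal ((1 + ‖z‖) ^ (-(d : ℝ))) ≤
        ENNReal.ofReal (C * Real.log (1 + R)) := by
  obtain ⟨C, hC, h⟩ := lintegral_comp_norm hd
  refine ⟨C, hC, fun R hR => ?_⟩
  set g : ℝ → ℝ := (Set.Icc 0 R).indicator fun y => (1 + y) ^ (-(d : ℝ)) with hg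
  have hinv : IntegrableOn (fun y : ℝ => (1 + y)⁻¹) (Set.Ioc 0 R) := by
    refine (ContinuousOn.integrableOn_Icc ?_).mono_set Set.Ioc_subset_Icc_self
    refine ContinuousOn.inv₀ (by fun_prop) fun y hy => ?_
    have := hy.1
    positivity
  have hgle : ∀ y ∈ Set.Ioi (0 : ℝ), y ^ (d - 1) * g y ≤
      (Set.Ioc 0 R).indicator (fun y : ℝ => (1 + y)⁻¹) y := by
    intro y hy
    have hy0 : 0 < y := hy
    by_cases hyR : y ≤ R
    · rw [hg, Set.indicator_of_mem (show y ∈ Set.Icc 0 R from ⟨hy0.le, hyR⟩),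
        Set.indicator_of_mem (show y ∈ Set.Ioc 0 R from ⟨hy0, hyR⟩), Real.rpow_neg (by positivity),
        Real.rpow_natCast, ← div_eq_mul_inv, div_le_iff₀ (by positivity)]
      obtain ⟨e, rfl⟩ : ∃ e, d = e + 1 := ⟨d - 1, by omega⟩
      rw [pow_succ' (1 + y), inv_mul_cancel_left₀ (by positivity)]
      exact pow_le_pow_left₀ hy0.le (by linarith) _
    · rw [hg, Set.indicator_of_notMem (show y ∉ Set.Icc 0 R from fun h => hyR h.2),
        Set.indicator_of_notMem (show y ∉ Set.Ioc 0 R from fun h => hyR h.2)]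
      simp
  have hg0 : ∀ y, 0 ≤ g y := fun y => Set.indicator_nonneg (fun y hy => by
    have := hy.1
    positivity) y
  have hgm : Measurable g := Measurable.indicator (by fun_prop) measurableSet_Icc
  have hri : IntegrableOn ((Set.Ioc 0 R).indicator (fun y : ℝ => (1 + y)⁻¹)) (Set.Ioi 0) :=
    (hinv.integrable_indicator measurableSet_Ioc).integrableOn
  have hli : IntegrableOn (fun y => y ^ (d - 1) * g y) (Set.Ioi 0) := by
    refine hri.mono' ((by fun_prop : Measurable fun y => y ^ (d - 1) * g y).aestronglyMeasurable) ?_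
    filter_upwards [ae_restrict_mem measurableSet_Ioi] with y hy
    rw [Real.norm_of_nonneg (mul_nonneg (pow_nonneg (le_of_lt hy) _) (hg0 y))]
    exact hgle y hy
  calc _ = ∫⁻ z : Space d, ENNReal.ofReal (g ‖z‖) := by
        rw [← lintegral_indicator measurableSet_closedBall]
        refine lintegral_congr fun z => ?_
        by_cases hz : ‖z‖ ≤ R
        · rw [Set.indicator_of_mem (by simpa using hz), hg, Set.indicator_of_mem]
          exact ⟨norm_nonneg z, hz⟩
        · rw [Set.indicator_of_notMem (by simpa using hz), hg,
            Set.indicator_of_notMem (show ‖z‖ ∉ Set.Icc 0 R from fun h => hz h.2)]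
          simp
    _ ≤ _ := by
        rw [h g hg0 hli]
        gcongr
        calc _ ≤ ∫ y in Set.Ioi (0 : ℝ), (Set.Ioc 0 R).indicator (fun y : ℝ => (1 + y)⁻¹) y :=
              setIntegral_mono_on hli hri measurableSet_Ioi hgle
          _ = ∫ y in (0 : ℝ)..R, (1 + y)⁻¹ := by
              rw [intervalIntegral.integral_of_le hR, setIntegral_indicator measurableSet_Ioc,
                Set.inter_eq_self_of_subset_right Set.Ioc_subset_Ioi_self]
          _ = Real.log (1 + R) := by
              rw [intervalIntegral.integral_comp_add_left (fun y => y⁻¹) 1,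
                integral_inv_of_pos (by norm_num) (by linarith)]
              simp

lemma setLIntegral_compl_ball_rpow {d : ℕ} (hd : 1 ≤ d) {r : ℝ} (hr : 0 < r) :
    ∃ C : ℝ, 0 ≤ C ∧ ∀ R : ℝ, 0 < R →
      ∫⁻ z in (Metric.closedBall (0 : Space d) R)ᶜ,
        ENNReal.ofReal ((1 + ‖z‖) ^ (-((d : ℝ) + r))) ≤ ENNReal.ofReal (C * R ^ (-r)) := by
  obtain ⟨C, hC, h⟩ := lintegral_comp_norm hd
  refine ⟨C * r⁻¹, by positivity, fun R hR => ?_⟩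
  set g : ℝ → ℝ := (Set.Ioi R).indicator fun y => (1 + y) ^ (-((d : ℝ) + r)) with hg
  have hgle : ∀ y ∈ Set.Ioi (0 : ℝ), y ^ (d - 1) * g y ≤
      (Set.Ioi R).indicator (fun y : ℝ => y ^ (-r - 1)) y := by
    intro y hy
    have hy0 : 0 < y := hy
    by_cases hyR : R < y
    · rw [hg, Set.indicator_of_mem (show y ∈ Set.Ioi R from hyR),
        Set.indicator_of_mem (show y ∈ Set.Ioi R from hyR), ← Real.rpow_natCast]
      calc _ ≤ y ^ ((d - 1 : ℕ) : ℝ) * y ^ (-((d : ℝ) + r)) := by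
            gcongr ?_ * ?_
            exact Real.rpow_le_rpow_of_nonpos hy0 (by linarith) (by linarith [d.cast_nonneg (α := ℝ)])
        _ = _ := by
            rw [← Real.rpow_add hy0]
            congr 1
            push_cast [Nat.cast_sub hd]
            ring
    · rw [hg, Set.indicator_of_notMem (show y ∉ Set.Ioi R from hyR),
        Set.indicator_of_notMem (show y ∉ Set.Ioi R from hyR)]
      simp
  have hg0 : ∀ y, 0 ≤ g y := fun y => Set.indicator_nonneg (fun y hy => by
    have : 0 < y := hR.trans hy
    positivity) y
  have hgm : Measurable g := Measurable.indicator (by fun_prop) measurableSet_Ioi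
  have hri : IntegrableOn ((Set.Ioi R).indicator (fun y : ℝ => y ^ (-r - 1))) (Set.Ioi 0) :=
    ((integrableOn_Ioi_rpow_of_lt (by linarith) hR).integrable_indicator
      measurableSet_Ioi).integrableOn
  have hli : IntegrableOn (fun y => y ^ (d - 1) * g y) (Set.Ioi 0) := by
    refine hri.mono' ((by fun_prop : Measurable fun y => y ^ (d - 1) * g y).aestronglyMeasurable) ?_
    filter_upwards [ae_restrict_mem measurableSet_Ioi] with y hy
    rw [Real.norm_of_nonneg (mul_nonneg (pow_nonneg (le_of_lt hy) _) (hg0 y))]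
    exact hgle y hy
  calc _ = ∫⁻ z : Space d, ENNReal.ofReal (g ‖z‖) := by
        rw [← lintegral_indicator measurableSet_closedBall.compl]
        refine lintegral_congr fun z => ?_
        by_cases hz : R < ‖z‖
        · rw [Set.indicator_of_mem (by simpa using hz), hg, Set.indicator_of_mem]
          exact hz
        · rw [Set.indicator_of_notMem (by simpa using hz), hg,
            Set.indicator_of_notMem (show ‖z‖ ∉ Set.Ioi R from hz)]
          simp
    _ ≤ _ := by
        rw [h g hg0 hli, mul_assoc]
        gcongr
        calc _ ≤ ∫ y in Set.Ioi (0 : ℝ), (Set.Ioi R).indicator (fun y : ℝ => y ^ (-r - 1)) y :=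
              setIntegral_mono_on hli hri measurableSet_Ioi hgle
          _ = ∫ y in Set.Ioi R, y ^ (-r - 1) := by
              rw [setIntegral_indicator measurableSet_Ioi,
                Set.inter_eq_self_of_subset_right (Set.Ioi_subset_Ioi hR.le)]
          _ = r⁻¹ * R ^ (-r) := by
              rw [integral_Ioi_rpow_of_lt (by linarith) hR]
              simp only [sub_add_cancel]
              field_simp

lemma rpow_neg_le_two_rpow_mul {a b s : ℝ} (ha : 0 < a) (hab : a ≤ 2 * b) (hs : 0 ≤ s) :
    b ^ (-s) ≤ 2 ^ s * a ^ (-s) := by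
  have hb : 0 < b := by linarith
  rw [Real.rpow_neg hb.le, Real.rpow_neg ha.le, ← div_eq_mul_inv, inv_eq_one_div,
    div_le_div_iff₀ (by positivity) (by positivity), one_mul, ← Real.mul_rpow (by norm_num) hb.le]
  exact Real.rpow_le_rpow ha.le hab hs

/-- The size of `⟨·⟩^{-d} * ⟨·⟩^{-r}`. -/
lemma lintegral_convolution_le {d : ℕ} (hd : 1 ≤ d) {r : ℝ} (hr : 0 < r) :
    ∃ C : ℝ, 0 ≤ C ∧ ∀ y : Space d,
      ∫⁻ x, ENNReal.ofReal ((1 + ‖y - x‖) ^ (-(d : ℝ)) * (1 + ‖x‖) ^ (-r)) ≤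
        ENNReal.ofReal (C * ((1 + ‖y‖) ^ (-r) * Real.log (1 + (1 + ‖y‖)) +
          (1 + ‖y‖) ^ (-(d : ℝ)))) := by
  obtain ⟨C₁, hC₁, h₁⟩ := setLIntegral_closedBall_log hd
  obtain ⟨C₂, hC₂, h₂⟩ := setLIntegral_compl_ball_rpow hd hr
  have hd0 : (0 : ℝ) ≤ d := d.cast_nonneg
  -- Three regions: `|x| ≤ |y|/2`, where `|y - x|` is at least of order `|y|`; larger `x` with `|y -
  -- x| ≤ 3(1 + |y|)`; and `|y - x| > 3(1 + |y|)`, where `|x|` is at least of order `|y - x|`.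
  have near : ∃ C : ℝ, 0 ≤ C ∧ ∀ y : Space d, ∫⁻ x in Metric.closedBall (0 : Space d) (‖y‖ / 2),
      ENNReal.ofReal ((1 + ‖y - x‖) ^ (-(d : ℝ)) * (1 + ‖x‖) ^ (-r)) ≤
        ENNReal.ofReal (C * ((1 + ‖y‖) ^ (-r) * Real.log (1 + (1 + ‖y‖)) +
          (1 + ‖y‖) ^ (-(d : ℝ)))) := by
    have hyx : ∀ x y : Space d, x ∈ Metric.closedBall (0 : Space d) (‖y‖ / 2) →
        (1 + ‖y - x‖) ^ (-(d : ℝ)) ≤ 2 ^ (d : ℝ) * (1 + ‖y‖) ^ (-(d : ℝ)) := by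
      intro x y hx
      have hx' : ‖x‖ ≤ ‖y‖ / 2 := by simpa using hx
      refine rpow_neg_le_two_rpow_mul (by positivity) ?_ hd0
      have := norm_sub_norm_le y x
      linarith
    -- The first factor contributes `(1+|y|)^{-d}`. For `r ≤ d`, the spare power `(1+|x|)^{d-r} ≤
    -- (1+|y|)^{d-r}` leaves the logarithmic integral. For `r > d`, the weight is integrable and the
    -- decay stays `(1+|y|)^{-d}`.
    rcases le_or_gt r d with hrd | hrd
    · refine ⟨2 ^ (d : ℝ) * C₁, by positivity, fun y => ?_⟩
      have hlog : 0 ≤ Real.log (1 + (1 + ‖y‖)) := Real.log_nonneg (by linarith [norm_nonneg y])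
      calc _ ≤ ∫⁻ x in Metric.closedBall (0 : Space d) (‖y‖ / 2), ENNReal.ofReal (2 ^ (d : ℝ) *
              (1 + ‖y‖) ^ (-r)) * ENNReal.ofReal ((1 + ‖x‖) ^ (-(d : ℝ))) := by
            refine setLIntegral_mono' measurableSet_closedBall fun x hx => ?_
            rw [← ENNReal.ofReal_mul (by positivity)]
            refine ENNReal.ofReal_le_ofReal ?_
            have hx' : ‖x‖ ≤ ‖y‖ / 2 := by simpa using hx
            have e : (1 + ‖x‖) ^ (-r) = (1 + ‖x‖) ^ (d - r) * (1 + ‖x‖) ^ (-(d : ℝ)) := by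
              rw [← Real.rpow_add (by positivity)]
              congr 1
              ring
            have e' : (1 + ‖y‖) ^ (-r) = (1 + ‖y‖) ^ (-(d : ℝ)) * (1 + ‖y‖) ^ (d - r) := by
              rw [← Real.rpow_add (by positivity)]
              congr 1
              ring
            calc _ ≤ (2 ^ (d : ℝ) * (1 + ‖y‖) ^ (-(d : ℝ))) *
                  ((1 + ‖y‖) ^ (d - r) * (1 + ‖x‖) ^ (-(d : ℝ))) := by
                  rw [e]
                  gcongr
                  · exact hyx x y hx
                  · linarith [norm_nonneg y]
              _ = _ := by rw [e']; ring
        _ = ENNReal.ofReal (2 ^ (d : ℝ) * (1 + ‖y‖) ^ (-r)) *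
              ∫⁻ x in Metric.closedBall (0 : Space d) (‖y‖ / 2), ENNReal.ofReal ((1 + ‖x‖) ^ (-(d : ℝ))) := by
            rw [lintegral_const_mul' _ _ ENNReal.ofReal_ne_top]
        _ ≤ ENNReal.ofReal (2 ^ (d : ℝ) * (1 + ‖y‖) ^ (-r)) *
              ENNReal.ofReal (C₁ * Real.log (1 + (1 + ‖y‖))) := by
            gcongr
            refine (h₁ _ (by positivity)).trans (ENNReal.ofReal_le_ofReal ?_)
            gcongr
            linarith [norm_nonneg y]
        _ ≤ _ := by
            rw [← ENNReal.ofReal_mul (by positivity)]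
            refine ENNReal.ofReal_le_ofReal ?_
            have : 0 ≤ 2 ^ (d : ℝ) * C₁ * (1 + ‖y‖) ^ (-(d : ℝ)) := by positivity
            linarith
    · have hfin := finite_integral_one_add_norm (E := Space d) (μ := volume) (r := r) (by simpa)
      refine ⟨2 ^ (d : ℝ) * (∫⁻ x : Space d, ENNReal.ofReal ((1 + ‖x‖) ^ (-r))).toReal,
        by positivity, fun y => ?_⟩
      have hlog : 0 ≤ Real.log (1 + (1 + ‖y‖)) := Real.log_nonneg (by linarith [norm_nonneg y])
      calc _ ≤ ∫⁻ x in Metric.closedBall (0 : Space d) (‖y‖ / 2), ENNReal.ofReal (2 ^ (d : ℝ) *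
              (1 + ‖y‖) ^ (-(d : ℝ))) * ENNReal.ofReal ((1 + ‖x‖) ^ (-r)) := by
            refine setLIntegral_mono' measurableSet_closedBall fun x hx => ?_
            rw [← ENNReal.ofReal_mul (by positivity)]
            refine ENNReal.ofReal_le_ofReal ?_
            gcongr
            exact hyx x y hx
        _ = ENNReal.ofReal (2 ^ (d : ℝ) * (1 + ‖y‖) ^ (-(d : ℝ))) *
              ∫⁻ x in Metric.closedBall (0 : Space d) (‖y‖ / 2), ENNReal.ofReal ((1 + ‖x‖) ^ (-r)) := by
            rw [lintegral_const_mul' _ _ ENNReal.ofReal_ne_top]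
        _ ≤ ENNReal.ofReal (2 ^ (d : ℝ) * (1 + ‖y‖) ^ (-(d : ℝ))) * ENNReal.ofReal
              (∫⁻ x : Space d, ENNReal.ofReal ((1 + ‖x‖) ^ (-r))).toReal := by
            gcongr
            rw [ENNReal.ofReal_toReal hfin.ne]
            exact setLIntegral_le_lintegral _ _
        _ ≤ _ := by
            rw [← ENNReal.ofReal_mul (by positivity)]
            refine ENNReal.ofReal_le_ofReal ?_
            have : 0 ≤ 2 ^ (d : ℝ) * (∫⁻ x : Space d, ENNReal.ofReal ((1 + ‖x‖) ^ (-r))).toReal *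
              ((1 + ‖y‖) ^ (-r) * Real.log (1 + (1 + ‖y‖))) := by positivity
            linarith
  obtain ⟨C₀, hC₀, h₀⟩ := near
  refine ⟨C₀ + 2 ^ r * C₁ * 2 + 2 ^ r * C₂ * 2, by positivity, fun y => ?_⟩
  set J := 1 + ‖y‖ with hJ
  have hJ1 : 1 ≤ J := by linarith [norm_nonneg y]
  have hJ0 : 0 < J := by linarith
  -- A lower bound for the logarithm lets a bare `J ^ (-r)` be absorbed into twice the logarithmic
  -- term.
  have hlog2 : 1 / 2 ≤ Real.log (1 + J) :=
    (by linarith [Real.log_two_gt_d9] : 1 / 2 ≤ Real.log 2).trans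
      (Real.log_le_log (by norm_num) (by linarith))
  have middle : ∫⁻ x in {x | y - x ∈ Metric.closedBall (0 : Space d) (3 * J)} \ Metric.closedBall (0 : Space d) (‖y‖ / 2),
      ENNReal.ofReal ((1 + ‖y - x‖) ^ (-(d : ℝ)) * (1 + ‖x‖) ^ (-r)) ≤
        ENNReal.ofReal (2 ^ r * C₁ * 2 * (J ^ (-r) * Real.log (1 + J))) := by
    have hms : MeasurableSet {x | y - x ∈ Metric.closedBall (0 : Space d) (3 * J)} :=
      (measurable_const.sub measurable_id) measurableSet_closedBall
    calc _ ≤ ∫⁻ x in {x | y - x ∈ Metric.closedBall (0 : Space d) (3 * J)} \ Metric.closedBall (0 : Space d) (‖y‖ / 2),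
            ENNReal.ofReal (2 ^ r * J ^ (-r)) * ENNReal.ofReal ((1 + ‖y - x‖) ^ (-(d : ℝ))) := by
          refine setLIntegral_mono' (hms.diff measurableSet_closedBall) fun x hx => ?_
          rw [← ENNReal.ofReal_mul (by positivity), mul_comm (_ ^ _) (_ ^ (-r))]
          refine ENNReal.ofReal_le_ofReal ?_
          have hx' : ‖y‖ / 2 < ‖x‖ := by simpa using hx.2
          gcongr
          exact rpow_neg_le_two_rpow_mul hJ0 (by linarith) hr.le
      _ ≤ ∫⁻ x in {x | y - x ∈ Metric.closedBall (0 : Space d) (3 * J)},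
            ENNReal.ofReal (2 ^ r * J ^ (-r)) * ENNReal.ofReal ((1 + ‖y - x‖) ^ (-(d : ℝ))) :=
          lintegral_mono_set Set.sdiff_subset
      _ = ENNReal.ofReal (2 ^ r * J ^ (-r)) * ∫⁻ x in Metric.closedBall (0 : Space d) (3 * J),
            ENNReal.ofReal ((1 + ‖x‖) ^ (-(d : ℝ))) := by
          rw [lintegral_const_mul' _ _ ENNReal.ofReal_ne_top, setLIntegral_sub_left
            (fun x => ENNReal.ofReal ((1 + ‖x‖) ^ (-(d : ℝ)))) measurableSet_closedBall]
      _ ≤ ENNReal.ofReal (2 ^ r * J ^ (-r)) * ENNReal.ofReal (C₁ * (2 * Real.log (1 + J))) := by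
          gcongr
          refine (h₁ _ (by positivity)).trans (ENNReal.ofReal_le_ofReal ?_)
          gcongr
          -- For `J ≥ 1`, `1 + 3J ≤ (1 + J)^2`; hence the factor `2`.
          have e : 2 * Real.log (1 + J) = Real.log ((1 + J) ^ 2) := by simp
          rw [e]
          exact Real.log_le_log (by positivity) (by nlinarith)
      _ = _ := by
          rw [← ENNReal.ofReal_mul (by positivity)]
          congr 1
          ring
  have far : ∫⁻ x in {x | y - x ∈ (Metric.closedBall (0 : Space d) (3 * J))ᶜ},
      ENNReal.ofReal ((1 + ‖y - x‖) ^ (-(d : ℝ)) * (1 + ‖x‖) ^ (-r)) ≤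
        ENNReal.ofReal (2 ^ r * C₂ * 2 * (J ^ (-r) * Real.log (1 + J))) := by
    have hms : MeasurableSet {x | y - x ∈ (Metric.closedBall (0 : Space d) (3 * J))ᶜ} :=
      (measurable_const.sub measurable_id) measurableSet_closedBall.compl
    calc _ ≤ ∫⁻ x in {x | y - x ∈ (Metric.closedBall (0 : Space d) (3 * J))ᶜ},
            ENNReal.ofReal (2 ^ r) * ENNReal.ofReal ((1 + ‖y - x‖) ^ (-((d : ℝ) + r))) := by
          refine setLIntegral_mono' hms fun x hx => ?_
          rw [← ENNReal.ofReal_mul (by positivity)]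
          refine ENNReal.ofReal_le_ofReal ?_
          have hx' : 3 * J < ‖y - x‖ := by simpa using hx
          have := norm_sub_le y x
          calc _ ≤ (1 + ‖y - x‖) ^ (-(d : ℝ)) * (2 ^ r * (1 + ‖y - x‖) ^ (-r)) := by
                gcongr
                exact rpow_neg_le_two_rpow_mul (by positivity) (by linarith) hr.le
            _ = _ := by
                rw [neg_add, Real.rpow_add (by positivity)]
                ring
      _ = ENNReal.ofReal (2 ^ r) * ∫⁻ x in (Metric.closedBall (0 : Space d) (3 * J))ᶜ,
            ENNReal.ofReal ((1 + ‖x‖) ^ (-((d : ℝ) + r))) := by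
          rw [lintegral_const_mul' _ _ ENNReal.ofReal_ne_top, setLIntegral_sub_left
            (fun x => ENNReal.ofReal ((1 + ‖x‖) ^ (-((d : ℝ) + r)))) measurableSet_closedBall.compl]
      _ ≤ ENNReal.ofReal (2 ^ r) * ENNReal.ofReal (C₂ * (2 * (J ^ (-r) * Real.log (1 + J)))) := by
          gcongr
          refine (h₂ _ (by positivity)).trans (ENNReal.ofReal_le_ofReal ?_)
          gcongr
          calc (3 * J) ^ (-r) ≤ J ^ (-r) :=
                Real.rpow_le_rpow_of_nonpos hJ0 (by linarith) (by linarith)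
            _ ≤ _ := by nlinarith [Real.rpow_pos_of_pos hJ0 (-r)]
      _ = _ := by
          rw [← ENNReal.ofReal_mul (by positivity)]
          congr 1
          ring
  have hlog0 : 0 ≤ Real.log (1 + J) := by linarith
  calc _ ≤ ∫⁻ x in Metric.closedBall (0 : Space d) (‖y‖ / 2) ∪
          (({x | y - x ∈ Metric.closedBall (0 : Space d) (3 * J)} \ Metric.closedBall (0 : Space d) (‖y‖ / 2)) ∪
            {x | y - x ∈ (Metric.closedBall (0 : Space d) (3 * J))ᶜ}),
          ENNReal.ofReal ((1 + ‖y - x‖) ^ (-(d : ℝ)) * (1 + ‖x‖) ^ (-r)) := by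
        rw [← setLIntegral_univ]
        refine lintegral_mono_set fun x _ => ?_
        by_cases h1 : x ∈ Metric.closedBall (0 : Space d) (‖y‖ / 2)
        · exact Or.inl h1
        · by_cases h2 : y - x ∈ Metric.closedBall (0 : Space d) (3 * J)
          · exact Or.inr (Or.inl ⟨h2, h1⟩)
          · exact Or.inr (Or.inr h2)
    _ ≤ _ := (lintegral_union_le _ _ _).trans
        (add_le_add (h₀ y) ((lintegral_union_le _ _ _).trans (add_le_add middle far)))
    _ ≤ _ := by
        rw [← ENNReal.ofReal_add (by positivity) (by positivity),
          ← ENNReal.ofReal_add (by positivity) (by positivity)]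
        refine ENNReal.ofReal_le_ofReal ?_
        have : 0 ≤ (2 ^ r * C₁ * 2 + 2 ^ r * C₂ * 2) * J ^ (-(d : ℝ)) := by positivity
        linarith

/-! ### Brackets, weights and the envelope -/

lemma one_le_bracket {d : ℕ} (x : Space d) : 1 ≤ bracket x := by
  rw [bracket, Real.one_le_sqrt]
  linarith [sq_nonneg ‖x‖]

lemma bracket_le {d : ℕ} (x : Space d) : bracket x ≤ 1 + ‖x‖ :=
  sqrt_one_add_norm_sq_le x

lemma norm_le_bracket {d : ℕ} (x : Space d) : ‖x‖ ≤ bracket x :=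
  Real.le_sqrt_of_sq_le (by linarith)

lemma le_two_mul_bracket {d : ℕ} (x : Space d) : 1 + ‖x‖ ≤ 2 * bracket x := by
  linarith [one_le_bracket x, norm_le_bracket x]

lemma continuous_bracket {d : ℕ} : Continuous (bracket (d := d)) := by
  unfold bracket
  fun_prop

/-- The decay of the convolution of `⟨·⟩^{-d}` and `⟨·⟩^{-r}`. -/
noncomputable def envelope (d : ℕ) (r : ℝ) (y : Space d) : ℝ :=
  (1 + ‖y‖) ^ (-r) * Real.log (1 + (1 + ‖y‖)) + (1 + ‖y‖) ^ (-(d : ℝ))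

lemma envelope_nonneg (d : ℕ) (r : ℝ) (y : Space d) : 0 ≤ envelope d r y := by
  have := Real.log_nonneg (show 1 ≤ 1 + (1 + ‖y‖) by linarith [norm_nonneg y])
  unfold envelope
  positivity

/-- A small power absorbs the logarithm. Boundedness places the image in unweighted `L^∞` and gives
the integrability needed for Fubini against a Schwartz function. -/
lemma envelope_le {d : ℕ} {r : ℝ} (hr : 0 < r) (y : Space d) : envelope d r y ≤ 2 ^ r / r + 1 := by
  have hJ : 1 ≤ 1 + ‖y‖ := by linarith [norm_nonneg y]
  have hJ0 : 0 < 1 + ‖y‖ := by positivity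
  unfold envelope
  gcongr
  · calc _ ≤ (1 + ‖y‖) ^ (-r) * ((2 * (1 + ‖y‖)) ^ r / r) := by
          gcongr
          refine (Real.log_le_rpow_div (by positivity) hr).trans ?_
          gcongr
          linarith
      _ = _ := by
          rw [Real.mul_rpow (by norm_num) hJ0.le, Real.rpow_neg hJ0.le]
          field_simp
  · exact Real.rpow_le_one_of_one_le_of_nonpos hJ (by simp)

lemma weightW_nonneg {d : ℕ} {r : ℝ} (y : Space d) : 0 ≤ weightW d r y := by
  have h1 := one_le_bracket y
  have := Real.log_nonneg (show 1 ≤ 1 + bracket y by linarith)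
  exact le_min (by positivity) (by positivity)

lemma continuous_weightW {d : ℕ} {r : ℝ} : Continuous (weightW d r) := by
  have hb := continuous_bracket (d := d)
  have h0 : ∀ x : Space d, bracket x ≠ 0 := fun x => by linarith [one_le_bracket x]
  have h1 : ∀ x : Space d, 1 + bracket x ≠ 0 := fun x => by linarith [one_le_bracket x]
  refine Continuous.min (Continuous.div (hb.rpow_const fun x => Or.inl (h0 x))
    (Continuous.log (by fun_prop) h1) fun x => ?_) (hb.pow d)
  exact (Real.log_pos (by linarith [one_le_bracket x])).ne'

/-- Each member of the minimum defining `w_r` cancels one summand of the envelope. The logarithmic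
one costs `2`, because `2 + |y| ≤ (1 + ⟨y⟩)^2`; the other costs `1`. -/
lemma weightW_mul_envelope_le {d : ℕ} {r : ℝ} (hr : 0 < r) (y : Space d) :
    weightW d r y * envelope d r y ≤ 3 := by
  have hb1 := one_le_bracket y
  have hb0 : 0 < bracket y := by linarith
  have hbJ := bracket_le y
  have hJb := le_two_mul_bracket y
  have hL : 0 < Real.log (1 + bracket y) := Real.log_pos (by linarith)
  have hlog : Real.log (1 + (1 + ‖y‖)) ≤ 2 * Real.log (1 + bracket y) := by
    have e : 2 * Real.log (1 + bracket y) = Real.log ((1 + bracket y) ^ 2) := by simp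
    rw [e]
    exact Real.log_le_log (by positivity) (by nlinarith)
  have hlog0 := Real.log_nonneg (show 1 ≤ 1 + (1 + ‖y‖) by linarith [norm_nonneg y])
  have h1 : weightW d r y * ((1 + ‖y‖) ^ (-r) * Real.log (1 + (1 + ‖y‖))) ≤ 2 := by
    calc _ ≤ (bracket y ^ r / Real.log (1 + bracket y)) *
          (bracket y ^ (-r) * (2 * Real.log (1 + bracket y))) := by
          gcongr ?_ * (?_ * ?_)
          · exact min_le_left _ _
          · exact Real.rpow_le_rpow_of_nonpos hb0 hbJ (by linarith)
      _ = 2 := by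
          rw [Real.rpow_neg hb0.le]
          field_simp
  have h2 : weightW d r y * (1 + ‖y‖) ^ (-(d : ℝ)) ≤ 1 := by
    calc _ ≤ bracket y ^ d * bracket y ^ (-(d : ℝ)) := by
          gcongr ?_ * ?_
          · exact min_le_right _ _
          · exact Real.rpow_le_rpow_of_nonpos hb0 hbJ (by simp)
      _ = 1 := by
          rw [Real.rpow_neg hb0.le, Real.rpow_natCast, mul_inv_cancel₀ (by positivity)]
  rw [envelope, mul_add]
  linarith

lemma weightedNorm_nonneg {d : ℕ} (w : Space d → ℝ) (f : Lp ℂ ⊤ (volume : Measure (Space d))) :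
    0 ≤ weightedNorm w f := ENNReal.toReal_nonneg

lemma ae_norm_le_weightedNorm {d : ℕ} {r : ℝ} (hr : 0 < r) (f : LinfWeighted (weightV d r)) :
    ∀ᵐ x, ‖f.1 x‖ ≤ 2 ^ r * weightedNorm (weightV d r) f.1 * (1 + ‖x‖) ^ (-r) := by
  have hf : MemLp (fun x => (weightV d r x : ℂ) * f.1 x) ⊤ volume := f.2
  have hfin := hf.2.ne
  have hae := ae_le_eLpNormEssSup (f := fun x => (weightV d r x : ℂ) * f.1 x)
    (μ := (volume : Measure (Space d)))
  filter_upwards [hae] with x hx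
  have hb0 : 0 < bracket x := by linarith [one_le_bracket x]
  have h1 : bracket x ^ r * ‖f.1 x‖ ≤ weightedNorm (weightV d r) f.1 := by
    have := ENNReal.toReal_mono (by simpa using hfin) hx
    rw [toReal_enorm, norm_mul, Complex.norm_real, Real.norm_of_nonneg (by
      unfold weightV; positivity)] at this
    simpa [weightedNorm, weightV] using this
  calc ‖f.1 x‖ = bracket x ^ r * ‖f.1 x‖ * bracket x ^ (-r) := by
        rw [Real.rpow_neg hb0.le]
        field_simp
    _ ≤ weightedNorm (weightV d r) f.1 * (2 ^ r * (1 + ‖x‖) ^ (-r)) := by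
        refine mul_le_mul h1 ?_ (by positivity) (weightedNorm_nonneg _ _)
        exact rpow_neg_le_two_rpow_mul (by positivity) (le_two_mul_bracket x) hr.le
    _ = _ := by ring

/-! ### From a kernel bound to an operator -/

set_option maxHeartbeats 1000000 in
/-- A multiplier given by convolution with a kernel that satisfies a Schur-type bound acts on
weighted `L^∞` spaces. -/
theorem exists_operator_of_kernel {d : ℕ} {r : ℝ} (hr : 0 < r) (q K : Space d → ℂ)
    (hK : StronglyMeasurable K) {C : ℝ} (hC : 0 ≤ C)
    (hbound : ∀ y, ∫⁻ x, ‖K (y - x)‖ₑ * ENNReal.ofReal ((1 + ‖x‖) ^ (-r)) ≤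
      ENNReal.ofReal (C * envelope d r y))
    (hmult : ∀ (φ : SchwartzMap (Space d) ℂ) (x : Space d),
      multiplier (fun ξ => q (-ξ)) φ x = ∫ y, K (y - x) * φ y) :
    ∃ T : LinfWeighted (weightV d r) →ₗ[ℂ] LinfWeighted (weightW d r),
      (∀ f : LinfWeighted (weightV d r),
        IsMultiplierImage q (f.1 : _ → ℂ) ((T f).1 : _ → ℂ)) ∧
      ∃ C : ℝ, ∀ f : LinfWeighted (weightV d r),
        weightedNorm (weightW d r) (T f).1 ≤ C * weightedNorm (weightV d r) f.1 := by
  set F : LinfWeighted (weightV d r) → ℝ := fun f => 2 ^ r * weightedNorm (weightV d r) f.1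
  have hF : ∀ f, 0 ≤ F f := fun f => mul_nonneg (by positivity) (weightedNorm_nonneg _ _)
  have hlint : ∀ f y, ∫⁻ x, ‖K (y - x) * f.1 x‖ₑ ≤
      ENNReal.ofReal (F f * C * envelope d r y) := by
    intro f y
    calc _ ≤ ∫⁻ x, ENNReal.ofReal (F f) *
          (‖K (y - x)‖ₑ * ENNReal.ofReal ((1 + ‖x‖) ^ (-r))) := by
          refine lintegral_mono_ae ?_
          filter_upwards [ae_norm_le_weightedNorm hr f] with x hx
          rw [enorm_mul, mul_left_comm, ← ENNReal.ofReal_mul (hF f)]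
          gcongr
          rw [← ofReal_norm]
          exact ENNReal.ofReal_le_ofReal hx
      _ ≤ _ := by
          rw [lintegral_const_mul' _ _ ENNReal.ofReal_ne_top, mul_assoc,
            ENNReal.ofReal_mul (hF f)]
          gcongr
          exact hbound y
  have hmeas2 : ∀ f : LinfWeighted (weightV d r),
      StronglyMeasurable fun z : Space d × Space d => K (z.1 - z.2) * f.1 z.2 := fun f =>
    (hK.comp_measurable (measurable_fst.sub measurable_snd)).mul
      ((Lp.stronglyMeasurable f.1).comp_measurable measurable_snd)
  -- Absolute convergence holds at every `y`, not just almost every one, so linearity in `f` can be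
  -- checked pointwise in `y`.
  have hint : ∀ (f : LinfWeighted (weightV d r)) y, Integrable fun x => K (y - x) * f.1 x := fun f y =>
    ⟨((hmeas2 f).comp_measurable measurable_prodMk_left).aestronglyMeasurable,
      (hlint f y).trans_lt ENNReal.ofReal_lt_top⟩
  set u : LinfWeighted (weightV d r) → Space d → ℂ := fun f y => ∫ x, K (y - x) * f.1 x with hu
  have hum : ∀ f, StronglyMeasurable (u f) := fun f => (hmeas2 f).integral_prod_right
  have hub : ∀ f y, ‖u f y‖ ≤ F f * C * envelope d r y := by
    intro f y
    have h1 := (enorm_integral_le_lintegral_enorm _).trans (hlint f y)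
    rw [← ofReal_norm] at h1
    exact (ENNReal.ofReal_le_ofReal_iff
      (mul_nonneg (mul_nonneg (hF f) hC) (envelope_nonneg d r y))).1 h1
  have humem : ∀ f, MemLp (u f) ⊤ (volume : Measure (Space d)) := fun f =>
    memLp_top_of_bound (hum f).aestronglyMeasurable (F f * C * (2 ^ r / r + 1))
      (Filter.Eventually.of_forall fun y => (hub f y).trans (by
        have := envelope_le hr y
        have := hF f
        gcongr))
  have hwb : ∀ f y, ‖(weightW d r y : ℂ) * u f y‖ ≤ F f * C * 3 := by
    intro f y
    have h0 := hF f
    rw [norm_mul, Complex.norm_real, Real.norm_of_nonneg (weightW_nonneg y)]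
    calc _ ≤ weightW d r y * (F f * C * envelope d r y) := by
          gcongr
          · exact weightW_nonneg y
          · exact hub f y
      _ = F f * C * (weightW d r y * envelope d r y) := by ring
      _ ≤ _ := by
          gcongr
          exact weightW_mul_envelope_le hr y
  have hwm : ∀ f, AEStronglyMeasurable (fun y => (weightW d r y : ℂ) * u f y) volume := fun f =>
    (Complex.continuous_ofReal.comp continuous_weightW).aestronglyMeasurable.mul
      (hum f).aestronglyMeasurable
  have hcoe : ∀ f, (fun y => (weightW d r y : ℂ) * ((humem f).toLp (u f)) y) =ᵐ[volume]
      fun y => (weightW d r y : ℂ) * u f y := fun f => by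
    filter_upwards [(humem f).coeFn_toLp] with y hy
    rw [hy]
  have hmem : ∀ f, (humem f).toLp (u f) ∈ LinfWeighted (weightW d r) := fun f =>
    (memLp_congr_ae (hcoe f)).2 (memLp_top_of_bound (hwm f) _
      (Filter.Eventually.of_forall (hwb f)))
  let T : LinfWeighted (weightV d r) →ₗ[ℂ] LinfWeighted (weightW d r) :=
    { toFun := fun f => ⟨(humem f).toLp (u f), hmem f⟩
      map_add' := by
        intro f g
        refine Subtype.ext ?_
        simp only [Submodule.coe_add]
        rw [← MemLp.toLp_add]
        refine MemLp.toLp_congr _ _ (Filter.Eventually.of_forall fun y => ?_)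
        simp only [hu, Pi.add_apply]
        rw [← integral_add (hint f y) (hint g y)]
        refine integral_congr_ae ?_
        filter_upwards [Lp.coeFn_add f.1 g.1] with x hx
        rw [Submodule.coe_add, hx, Pi.add_apply, mul_add]
      map_smul' := by
        intro c f
        refine Subtype.ext ?_
        simp only [Submodule.coe_smul, RingHom.id_apply]
        rw [← MemLp.toLp_const_smul]
        refine MemLp.toLp_congr _ _ (Filter.Eventually.of_forall fun y => ?_)
        simp only [hu, Pi.smul_apply]
        rw [← integral_smul]
        refine integral_congr_ae ?_
        filter_upwards [Lp.coeFn_smul c f.1] with x hx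
        rw [Submodule.coe_smul, hx, Pi.smul_apply, smul_eq_mul, smul_eq_mul, mul_left_comm] }
  refine ⟨T, fun f φ => ?_, 2 ^ r * C * 3, fun f => ?_⟩
  · have hTf : ((T f).1 : Space d → ℂ) =ᵐ[volume] u f := (humem f).coeFn_toLp
    have hm3 : StronglyMeasurable fun z : Space d × Space d => f.1 z.1 * (K (z.2 - z.1) * φ z.2) :=
      ((Lp.stronglyMeasurable f.1).comp_measurable measurable_fst).mul
        ((hK.comp_measurable (measurable_snd.sub measurable_fst)).mul
          (φ.continuous.stronglyMeasurable.comp_measurable measurable_snd))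
    -- Integrating in `x` first leaves a bounded function of `y` times `|φ|`. The resulting Fubini
    -- swap is the whole transpose identity.
    have hi3 : Integrable (fun z : Space d × Space d => f.1 z.1 * (K (z.2 - z.1) * φ z.2))
        (volume.prod volume) := by
      refine ⟨hm3.aestronglyMeasurable, ?_⟩
      rw [HasFiniteIntegral, lintegral_prod_symm _ hm3.enorm.aemeasurable]
      calc _ ≤ ∫⁻ y, ENNReal.ofReal (F f * C * (2 ^ r / r + 1)) * ‖φ y‖ₑ := by
            refine lintegral_mono fun y => ?_
            calc _ = ∫⁻ x, ‖K (y - x) * f.1 x‖ₑ * ‖φ y‖ₑ := by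
                  refine lintegral_congr fun x => ?_
                  simp only [enorm_mul]
                  ring
              _ = (∫⁻ x, ‖K (y - x) * f.1 x‖ₑ) * ‖φ y‖ₑ :=
                  lintegral_mul_const' _ _ enorm_ne_top
              _ ≤ _ := by
                  gcongr
                  refine (hlint f y).trans (ENNReal.ofReal_le_ofReal ?_)
                  have := envelope_le hr y
                  have := hF f
                  gcongr
        _ < ⊤ := by
            rw [lintegral_const_mul' _ _ ENNReal.ofReal_ne_top]
            exact ENNReal.mul_lt_top ENNReal.ofReal_lt_top (φ.integrable (μ := volume)).2
    have e1 : (fun x => ∫ y, f.1 x * (K (y - x) * φ y)) =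
        fun x => f.1 x * multiplier (fun ξ => q (-ξ)) φ x := by
      funext x
      rw [hmult, integral_const_mul]
    have e2 : (fun y => ∫ x, f.1 x * (K (y - x) * φ y)) = fun y => u f y * φ y := by
      funext y
      rw [hu]
      simp only
      rw [← integral_mul_const]
      refine integral_congr_ae (Filter.Eventually.of_forall fun x => ?_)
      simp only
      ring
    have hae : (fun x => (T f).1 x * φ x) =ᵐ[volume] fun y => u f y * φ y := by
      filter_upwards [hTf] with y hy
      rw [hy]
    refine ⟨?_, ?_, ?_⟩
    · rw [integrable_congr hae, ← e2]
      exact hi3.integral_prod_right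
    · rw [← e1]
      exact hi3.integral_prod_left
    · rw [integral_congr_ae hae, ← e2, ← e1]
      exact (integral_integral_swap hi3).symm
  · have h0 : 0 ≤ F f * C * 3 := by
      have := hF f
      positivity
    calc weightedNorm (weightW d r) (T f).1 ≤ F f * C * 3 := by
          refine ENNReal.toReal_le_of_le_ofReal h0 ?_
          have e : (fun y => (weightW d r y : ℂ) * (T f).1 y) =ᵐ[volume]
              fun y => (weightW d r y : ℂ) * u f y := hcoe f
          rw [eLpNorm_congr_ae e, eLpNorm_exponent_top]
          exact eLpNormEssSup_le_of_ae_bound (Filter.Eventually.of_forall (hwb f))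
      _ = _ := by
          simp only [F]
          ring

/-! ### Dyadic majorants and their weighted integrals -/

/-- The model bound for an `L^1`-normalised kernel at frequency `s`. -/
noncomputable def profile (d N : ℕ) (s : ℝ) (z : Space d) : ℝ := s ^ d * ((1 + s * ‖z‖) ^ N)⁻¹

lemma profile_nonneg {d N : ℕ} {s : ℝ} (hs : 0 ≤ s) (z : Space d) : 0 ≤ profile d N s z := by
  unfold profile
  positivity

/-- The right side is built to telescope in `n`. With `v = s(1+|z|)` and `s ≤ 1`, `1 + s|z| ≥
(1+v)/2` reduces the claim to `v^d (1+v)^{-N} ≤ 2v / ((1+v)(2+v))`, and `v / ((1+v)(2+v))` is the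
increment of `v/(1+v)` between `v/2` and `v`. -/
lemma profile_half_pow_le {d N : ℕ} (hd : 1 ≤ d) (hN : d + 1 ≤ N) (n : ℕ) (z : Space d) :
    profile d N ((1 / 2) ^ n) z ≤ 2 ^ (N + 1) * (1 + ‖z‖) ^ (-(d : ℝ)) *
      ((1 / 2) ^ n * (1 + ‖z‖) / (1 + (1 / 2) ^ n * (1 + ‖z‖)) -
        (1 / 2) ^ (n + 1) * (1 + ‖z‖) / (1 + (1 / 2) ^ (n + 1) * (1 + ‖z‖))) := by
  set s : ℝ := (1 / 2) ^ n with hs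
  have hs0 : 0 < s := by positivity
  have hs1 : s ≤ 1 := pow_le_one₀ (by norm_num) (by norm_num)
  set X := 1 + ‖z‖ with hX
  have hX0 : 0 < X := by positivity
  set v := s * X with hv
  have hv0 : 0 < v := by positivity
  have e2 : (1 / 2) ^ (n + 1) * X = v / 2 := by
    rw [pow_succ, hv, hs]
    ring
  rw [e2]
  have e3 : v / (1 + v) - v / 2 / (1 + v / 2) = v / ((1 + v) * (2 + v)) := by
    field_simp
    ring
  rw [e3, Real.rpow_neg hX0.le, Real.rpow_natCast]
  have h1 : (1 + v) / 2 ≤ 1 + s * ‖z‖ := by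
    rw [hv, hX]
    nlinarith [norm_nonneg z]
  obtain ⟨e, rfl⟩ : ∃ e, d = e + 1 := ⟨d - 1, by omega⟩
  obtain ⟨k, rfl⟩ : ∃ k, N = e + 2 + k := ⟨N - (e + 2), by omega⟩
  have hle : v ^ (e + 1) * ((1 + v) ^ (e + 2 + k))⁻¹ ≤ 2 * (v / ((1 + v) * (2 + v))) := by
    have ha : v ^ e ≤ (1 + v) ^ e := pow_le_pow_left₀ hv0.le (by linarith) _
    have hb : 1 ≤ (1 + v) ^ k := one_le_pow₀ (by linarith)
    rw [← div_eq_mul_inv, mul_div_assoc', div_le_div_iff₀ (by positivity) (by positivity)]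
    have hc : v ^ e ≤ (1 + v) ^ e * (1 + v) ^ k := by nlinarith [pow_nonneg hv0.le e]
    calc v ^ (e + 1) * ((1 + v) * (2 + v)) = v ^ e * (v * ((1 + v) * (2 + v))) := by ring
      _ ≤ ((1 + v) ^ e * (1 + v) ^ k) * (v * ((1 + v) * (2 * (1 + v)))) := by
          gcongr
          linarith
      _ = _ := by ring
  calc profile (e + 1) (e + 2 + k) s z
      ≤ s ^ (e + 1) * (((1 + v) / 2) ^ (e + 2 + k))⁻¹ := by
        unfold profile
        gcongr
    _ = 2 ^ (e + 2 + k) * (X ^ (e + 1))⁻¹ * (v ^ (e + 1) * ((1 + v) ^ (e + 2 + k))⁻¹) := by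
        rw [div_pow, hv, mul_pow]
        field_simp
    _ ≤ 2 ^ (e + 2 + k) * (X ^ (e + 1))⁻¹ * (2 * (v / ((1 + v) * (2 + v)))) := by gcongr
    _ = _ := by ring

lemma tsum_profile_half_pow_le {d N : ℕ} (hd : 1 ≤ d) (hN : d + 1 ≤ N) (z : Space d) :
    ∑' n : ℕ, ENNReal.ofReal (profile d N ((1 / 2) ^ n) z) ≤
      ENNReal.ofReal (2 ^ (N + 1) * (1 + ‖z‖) ^ (-(d : ℝ))) := by
  refine ENNReal.tsum_le_of_sum_range_le fun m => ?_
  rw [← ENNReal.ofReal_sum_of_nonneg fun n _ => profile_nonneg (by positivity) z]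
  refine ENNReal.ofReal_le_ofReal ?_
  refine (Finset.sum_le_sum fun n _ => profile_half_pow_le hd hN n z).trans ?_
  rw [← Finset.mul_sum, Finset.sum_range_sub']
  refine mul_le_of_le_one_right (by positivity) ?_
  have h1 : (1 / 2 : ℝ) ^ 0 * (1 + ‖z‖) / (1 + (1 / 2) ^ 0 * (1 + ‖z‖)) ≤ 1 :=
    div_le_one_of_le₀ (by linarith) (by positivity)
  have h2 : 0 ≤ (1 / 2 : ℝ) ^ m * (1 + ‖z‖) / (1 + (1 / 2) ^ m * (1 + ‖z‖)) := by positivity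
  linarith

lemma lintegral_comp_smul_space {d : ℕ} {s : ℝ} (hs : 0 < s) {F : Space d → ENNReal}
    (hF : Measurable F) :
    ENNReal.ofReal (s ^ d) * ∫⁻ z : Space d, F (s • z) = ∫⁻ z, F z := by
  have h := Measure.map_addHaar_smul (volume : Measure (Space d)) hs.ne'
  rw [← lintegral_map hF (measurable_const_smul s), h, lintegral_smul_measure, smul_eq_mul,
    ← mul_assoc, ← ENNReal.ofReal_mul (by positivity), finrank_euclideanSpace_fin,
    abs_of_pos (by positivity), mul_inv_cancel₀ (by positivity), ENNReal.ofReal_one, one_mul]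

/-- For `s ≥ 1`, `1 + |y| ≤ (1 + s|y-x|)(1 + |x|)`, so the weight moves from `x` to `y` at the price
of `r` powers of the profile. The remaining `N - r > d` powers are integrable, with an integral that
scaling makes independent of `s`. -/
lemma lintegral_profile_mul_le {d N : ℕ} {r : ℝ} (hr : 0 < r) (hN : d + r < N) :
    ∃ C : ℝ, 0 ≤ C ∧ ∀ s : ℝ, 1 ≤ s → ∀ y : Space d,
      ∫⁻ x, ENNReal.ofReal (profile d N s (y - x)) * ENNReal.ofReal ((1 + ‖x‖) ^ (-r)) ≤
        ENNReal.ofReal (C * (1 + ‖y‖) ^ (-r)) := by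
  have hfin := finite_integral_one_add_norm (E := Space d) (μ := volume) (r := N - r)
    (by simp; linarith)
  refine ⟨(∫⁻ x : Space d, ENNReal.ofReal ((1 + ‖x‖) ^ (-(N - r)))).toReal, by positivity,
    fun s hs y => ?_⟩
  have hs0 : 0 < s := by linarith
  have hpt : ∀ x, profile d N s (y - x) * (1 + ‖x‖) ^ (-r) ≤
      (1 + ‖y‖) ^ (-r) * (s ^ d * (1 + ‖s • (y - x)‖) ^ (-(N - r))) := by
    intro x
    have hsn : ‖s • (y - x)‖ = s * ‖y - x‖ := by rw [norm_smul, Real.norm_of_nonneg hs0.le]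
    have h1 : 1 + ‖y‖ ≤ (1 + ‖s • (y - x)‖) * (1 + ‖x‖) := by
      have h2 : ‖y‖ ≤ ‖y - x‖ + ‖x‖ := by simpa using norm_add_le (y - x) x
      have h3 : ‖y - x‖ ≤ s * ‖y - x‖ := le_mul_of_one_le_left (norm_nonneg _) hs
      rw [hsn]
      nlinarith [norm_nonneg x, norm_nonneg (y - x), mul_nonneg (mul_nonneg hs0.le
        (norm_nonneg (y - x))) (norm_nonneg x)]
    have h4 : (1 + ‖x‖) ^ (-r) ≤ (1 + ‖y‖) ^ (-r) * (1 + ‖s • (y - x)‖) ^ r := by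
      have h5 := Real.rpow_le_rpow_of_nonpos (z := -r) (by positivity) h1 (by linarith)
      rw [Real.mul_rpow (by positivity) (by positivity), Real.rpow_neg (by positivity) (r)] at h5
      rwa [inv_mul_le_iff₀ (by positivity), mul_comm] at h5
    calc _ ≤ profile d N s (y - x) * ((1 + ‖y‖) ^ (-r) * (1 + ‖s • (y - x)‖) ^ r) := by
          gcongr
          exact profile_nonneg hs0.le _
      _ = _ := by
          rw [profile, ← hsn, ← Real.rpow_natCast (1 + _), ← Real.rpow_neg (by positivity),
            neg_sub, sub_eq_neg_add r (N : ℝ), Real.rpow_add (by positivity)]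
          ring
  calc _ ≤ ∫⁻ x, ENNReal.ofReal ((1 + ‖y‖) ^ (-r)) * (ENNReal.ofReal (s ^ d) *
        ENNReal.ofReal ((1 + ‖s • (y - x)‖) ^ (-(N - r)))) := by
        refine lintegral_mono fun x => ?_
        rw [← ENNReal.ofReal_mul (profile_nonneg hs0.le _), ← ENNReal.ofReal_mul (by positivity),
          ← ENNReal.ofReal_mul (by positivity)]
        exact ENNReal.ofReal_le_ofReal (hpt x)
    _ = ENNReal.ofReal ((1 + ‖y‖) ^ (-r)) *
        ∫⁻ x : Space d, ENNReal.ofReal ((1 + ‖x‖) ^ (-(N - r))) := by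
        rw [lintegral_const_mul' _ _ ENNReal.ofReal_ne_top,
          lintegral_const_mul' _ _ ENNReal.ofReal_ne_top,
          lintegral_sub_left_eq_self
            (fun x => ENNReal.ofReal ((1 + ‖s • x‖) ^ (-(N - r)))) y,
          lintegral_comp_smul_space hs0
            (F := fun x => ENNReal.ofReal ((1 + ‖x‖) ^ (-(N - r)))) (by fun_prop)]
    _ ≤ _ := by
        rw [mul_comm _ ((1 + ‖y‖) ^ (-r)), ENNReal.ofReal_mul (by positivity),
          ENNReal.ofReal_toReal hfin.ne]

/-- The `n`-th term of the dyadic majorant: frequency `2^{-n}` and frequency `2^{n+1}`. -/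
noncomputable def dyadicTerm (d N : ℕ) (M : ℝ) (n : ℕ) (z : Space d) : ℝ :=
  profile d N ((1 / 2) ^ n) z + ((2 : ℝ) ^ (n + 1)) ^ (-M) * profile d N (2 ^ (n + 1)) z

lemma measurable_profile {d N : ℕ} {s : ℝ} : Measurable (profile d N s) := by
  unfold profile
  fun_prop

lemma measurable_dyadicTerm {d N : ℕ} {M : ℝ} (n : ℕ) : Measurable (dyadicTerm d N M n) :=
  measurable_profile.add (measurable_profile.const_mul _)

lemma dyadicTerm_sub_comm {d N : ℕ} {M : ℝ} (n : ℕ) (x y : Space d) :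
    dyadicTerm d N M n (x - y) = dyadicTerm d N M n (y - x) := by
  simp only [dyadicTerm, profile, norm_sub_rev]

/-- Low frequencies are summed pointwise, before integrating. High frequencies are integrated first:
their pointwise sum is infinite at the origin when `M ≤ d`, while their weighted integrals decay
like powers of `ρ = 2^{-M} < 1`. -/
lemma lintegral_tsum_dyadicTerm_le {d N : ℕ} (hd : 1 ≤ d) {r M : ℝ} (hr : 0 < r) (hM : 0 < M)
    (hN : d + 1 ≤ N) (hN' : d + r < N) :
    ∃ C : ℝ, 0 ≤ C ∧ ∀ y : Space d,
      ∫⁻ x, (∑' n, ENNReal.ofReal (dyadicTerm d N M n (y - x))) *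
        ENNReal.ofReal ((1 + ‖x‖) ^ (-r)) ≤ ENNReal.ofReal (C * envelope d r y) := by
  obtain ⟨C₁, hC₁, h₁⟩ := lintegral_convolution_le hd hr
  obtain ⟨C₂, hC₂, h₂⟩ := lintegral_profile_mul_le hr hN'
  set ρ : ℝ := 2 ^ (-M) with hρ
  have hρ0 : 0 < ρ := by positivity
  have hρ1 : ρ < 1 := Real.rpow_lt_one_of_one_lt_of_neg (by norm_num) (by linarith)
  have hpow : ∀ n : ℕ, ((2 : ℝ) ^ (n + 1)) ^ (-M) = ρ ^ (n + 1) := by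
    intro n
    rw [hρ, ← Real.rpow_natCast, ← Real.rpow_natCast, ← Real.rpow_mul (by norm_num),
      ← Real.rpow_mul (by norm_num), mul_comm]
  refine ⟨2 ^ (N + 1) * C₁ + 2 * ((1 - ρ)⁻¹ * C₂), by
    have : 0 ≤ (1 - ρ)⁻¹ := inv_nonneg.2 (by linarith)
    positivity, fun y => ?_⟩
  have hJ : 1 ≤ 1 + ‖y‖ := by linarith [norm_nonneg y]
  have hlog : 1 / 2 ≤ Real.log (1 + (1 + ‖y‖)) :=
    (by linarith [Real.log_two_gt_d9] : 1 / 2 ≤ Real.log 2).trans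
      (Real.log_le_log (by norm_num) (by linarith))
  have hm : ∀ s, Measurable fun x : Space d => profile d N s (y - x) := fun s =>
    measurable_profile.comp (measurable_const.sub measurable_id)
  have hw : Measurable fun x : Space d => ENNReal.ofReal ((1 + ‖x‖) ^ (-r)) := by fun_prop
  have hsplit : ∀ x : Space d, (∑' n, ENNReal.ofReal (dyadicTerm d N M n (y - x))) *
      ENNReal.ofReal ((1 + ‖x‖) ^ (-r)) =
      (∑' n : ℕ, ENNReal.ofReal (profile d N ((1 / 2) ^ n) (y - x))) *
        ENNReal.ofReal ((1 + ‖x‖) ^ (-r)) +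
      ∑' n : ℕ, ENNReal.ofReal (ρ ^ (n + 1)) * (ENNReal.ofReal (profile d N (2 ^ (n + 1)) (y - x)) *
        ENNReal.ofReal ((1 + ‖x‖) ^ (-r))) := by
    intro x
    have e : ∀ n, ENNReal.ofReal (dyadicTerm d N M n (y - x)) =
        ENNReal.ofReal (profile d N ((1 / 2) ^ n) (y - x)) +
          ENNReal.ofReal (ρ ^ (n + 1)) * ENNReal.ofReal (profile d N (2 ^ (n + 1)) (y - x)) := by
      intro n
      have h0 := profile_nonneg (d := d) (N := N) (s := (1 / 2) ^ n) (by positivity) (y - x)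
      have h1 := profile_nonneg (d := d) (N := N) (s := 2 ^ (n + 1)) (by positivity) (y - x)
      rw [dyadicTerm, hpow, ENNReal.ofReal_add h0 (by positivity),
        ENNReal.ofReal_mul (by positivity)]
    simp_rw [e]
    rw [ENNReal.tsum_add, add_mul]
    congr 1
    rw [← ENNReal.tsum_mul_right]
    exact tsum_congr fun n => mul_assoc _ _ _
  simp_rw [hsplit]
  rw [lintegral_add_left (by
    refine Measurable.mul (Measurable.tsum fun n => ?_) hw
    exact (hm _).ennreal_ofReal)]
  have low : ∫⁻ x, (∑' n : ℕ, ENNReal.ofReal (profile d N ((1 / 2) ^ n) (y - x))) *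
      ENNReal.ofReal ((1 + ‖x‖) ^ (-r)) ≤ ENNReal.ofReal (2 ^ (N + 1) * C₁ * envelope d r y) := by
    calc _ ≤ ∫⁻ x, ENNReal.ofReal (2 ^ (N + 1)) *
          ENNReal.ofReal ((1 + ‖y - x‖) ^ (-(d : ℝ)) * (1 + ‖x‖) ^ (-r)) := by
          refine lintegral_mono fun x => ?_
          calc _ ≤ ENNReal.ofReal (2 ^ (N + 1) * (1 + ‖y - x‖) ^ (-(d : ℝ))) *
                ENNReal.ofReal ((1 + ‖x‖) ^ (-r)) := by
                gcongr
                exact tsum_profile_half_pow_le hd hN _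
            _ = _ := by
                rw [ENNReal.ofReal_mul (by positivity), ENNReal.ofReal_mul (by positivity),
                  mul_assoc]
      _ ≤ ENNReal.ofReal (2 ^ (N + 1)) * ENNReal.ofReal (C₁ * envelope d r y) := by
          rw [lintegral_const_mul' _ _ ENNReal.ofReal_ne_top]
          gcongr
          exact h₁ y
      _ = _ := by rw [← ENNReal.ofReal_mul (by positivity), mul_assoc]
  have high : ∫⁻ x, ∑' n : ℕ, ENNReal.ofReal (ρ ^ (n + 1)) *
      (ENNReal.ofReal (profile d N (2 ^ (n + 1)) (y - x)) * ENNReal.ofReal ((1 + ‖x‖) ^ (-r))) ≤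
        ENNReal.ofReal (2 * ((1 - ρ)⁻¹ * C₂) * envelope d r y) := by
    have hmn : ∀ n : ℕ, AEMeasurable (fun x : Space d => ENNReal.ofReal (ρ ^ (n + 1)) *
        (ENNReal.ofReal (profile d N (2 ^ (n + 1)) (y - x)) *
          ENNReal.ofReal ((1 + ‖x‖) ^ (-r)))) volume := fun n =>
      (((hm _).ennreal_ofReal.mul hw).const_mul _).aemeasurable
    rw [lintegral_tsum hmn]
    calc _ ≤ ∑' n : ℕ, ENNReal.ofReal (ρ ^ n) * ENNReal.ofReal (C₂ * (1 + ‖y‖) ^ (-r)) := by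
          refine ENNReal.tsum_le_tsum fun n => ?_
          rw [lintegral_const_mul' _ _ ENNReal.ofReal_ne_top]
          gcongr ENNReal.ofReal ?_ * ?_
          · exact pow_le_pow_of_le_one hρ0.le hρ1.le (Nat.le_succ n)
          · exact h₂ _ (one_le_pow₀ (by norm_num)) y
      _ = ENNReal.ofReal ((1 - ρ)⁻¹ * (C₂ * (1 + ‖y‖) ^ (-r))) := by
          rw [ENNReal.tsum_mul_right, ← ENNReal.ofReal_tsum_of_nonneg (fun n => by positivity)
            (summable_geometric_of_lt_one hρ0.le hρ1), tsum_geometric_of_lt_one hρ0.le hρ1,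
            ENNReal.ofReal_mul (inv_nonneg.2 (by linarith))]
      _ ≤ _ := by
          refine ENNReal.ofReal_le_ofReal ?_
          have h0 : 0 ≤ (1 - ρ)⁻¹ * C₂ := mul_nonneg (inv_nonneg.2 (by linarith)) hC₂
          have h1 : 0 ≤ (1 + ‖y‖) ^ (-r) := by positivity
          have h2 : 0 ≤ (1 + ‖y‖) ^ (-(d : ℝ)) := by positivity
          have h3 : (1 + ‖y‖) ^ (-r) ≤ 2 * envelope d r y := by
            unfold envelope
            nlinarith
          calc _ = ((1 - ρ)⁻¹ * C₂) * (1 + ‖y‖) ^ (-r) := by ring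
            _ ≤ ((1 - ρ)⁻¹ * C₂) * (2 * envelope d r y) := by gcongr
            _ = _ := by ring
  have h0 : 0 ≤ (1 - ρ)⁻¹ * C₂ := mul_nonneg (inv_nonneg.2 (by linarith)) hC₂
  have he := envelope_nonneg d r y
  refine (add_le_add low high).trans ?_
  rw [← ENNReal.ofReal_add (by positivity) (by positivity)]
  exact ENNReal.ofReal_le_ofReal (by linarith)

/-! ### Kernels given by a series -/

lemma exists_schwartz_norm_le {d : ℕ} (φ : SchwartzMap (Space d) ℂ) (r : ℝ) :
    ∃ C : ℝ, 0 ≤ C ∧ ∀ y, ‖φ y‖ ≤ C * (1 + ‖y‖) ^ (-r) := by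
  obtain ⟨k, hk⟩ := exists_nat_ge r
  have h := fun y => SchwartzMap.one_add_le_sup_seminorm_apply (𝕜 := ℂ) (m := (k, 0)) (k := k)
    (n := 0) le_rfl le_rfl φ y
  simp only [norm_iteratedFDeriv_zero] at h
  refine ⟨_, (mul_nonneg (by positivity) (norm_nonneg _)).trans (h 0), fun y => ?_⟩
  rw [Real.rpow_neg (by positivity), ← div_eq_mul_inv, le_div_iff₀ (by positivity)]
  refine le_trans ?_ (h y)
  rw [mul_comm]
  gcongr
  rw [← Real.rpow_natCast]
  exact Real.rpow_le_rpow_of_exponent_le (by linarith [norm_nonneg y]) hk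

set_option maxHeartbeats 1000000 in
-- The series need only converge almost everywhere, so the kernel is a measurable representative of
-- its sum. The multiplier hypothesis is a limit over partial sums because the full symbol need not
-- be integrable.
theorem exists_operator_of_kernel_series {d N : ℕ} (hd : 1 ≤ d) {r M : ℝ} (hr : 0 < r) (hM : 0 < M)
    (hN : d + 1 ≤ N) (hN' : d + r < N) (q : Space d → ℂ) (k : ℕ → Space d → ℂ)
    (hk : ∀ n, Continuous (k n)) {D : ℝ} (hD : 0 ≤ D)
    (hkb : ∀ n z, ‖k n z‖ ≤ D * dyadicTerm d N M n z)
    (hmult : ∀ (φ : SchwartzMap (Space d) ℂ) (x : Space d),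
      Filter.Tendsto (fun m => ∫ y, (∑ n ∈ Finset.range m, k n (y - x)) * φ y) Filter.atTop
        (nhds (multiplier (fun ξ => q (-ξ)) φ x))) :
    ∃ T : LinfWeighted (weightV d r) →ₗ[ℂ] LinfWeighted (weightW d r),
      (∀ f : LinfWeighted (weightV d r),
        IsMultiplierImage q (f.1 : _ → ℂ) ((T f).1 : _ → ℂ)) ∧
      ∃ C : ℝ, ∀ f : LinfWeighted (weightV d r),
        weightedNorm (weightW d r) (T f).1 ≤ C * weightedNorm (weightV d r) f.1 := by
  obtain ⟨C, hC, hG⟩ := lintegral_tsum_dyadicTerm_le hd hr hM hN hN'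
  set G : Space d → ENNReal := fun z => ∑' n, ENNReal.ofReal (dyadicTerm d N M n z) with hGdef
  have hGm : Measurable G := Measurable.tsum fun n =>
    (measurable_dyadicTerm n).ennreal_ofReal
  have hGsymm : ∀ x y, G (x - y) = G (y - x) := fun x y => by
    simp only [hGdef, dyadicTerm_sub_comm _ x y]
  have hwpos : ∀ x : Space d, ENNReal.ofReal ((1 + ‖x‖) ^ (-r)) ≠ 0 := fun x => by
    rw [Ne, ENNReal.ofReal_eq_zero, not_le]
    positivity
  -- A finite integral against a strictly positive weight forces finiteness almost everywhere.
  have hGfin : ∀ y, ∀ᵐ x, G (y - x) < ⊤ := by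
    intro y
    have hm : Measurable fun x => G (y - x) * ENNReal.ofReal ((1 + ‖x‖) ^ (-r)) := by fun_prop
    have h1 := ae_lt_top hm ((hG y).trans_lt ENNReal.ofReal_lt_top).ne
    filter_upwards [h1] with x hx
    by_contra hcon
    rw [not_lt_top_iff] at hcon
    rw [hcon, ENNReal.top_mul (hwpos x)] at hx
    exact lt_irrefl _ hx
  have hkG : ∀ z, ∑' n, ‖k n z‖ₑ ≤ ENNReal.ofReal D * G z := by
    intro z
    rw [hGdef, ← ENNReal.tsum_mul_left]
    refine ENNReal.tsum_le_tsum fun n => ?_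
    rw [← ofReal_norm, ← ENNReal.ofReal_mul hD]
    exact ENNReal.ofReal_le_ofReal (hkb n z)
  have hsum : ∀ z, G z < ⊤ → Summable fun n => k n z := fun z hz =>
    Summable.of_enorm ((hkG z).trans_lt (ENNReal.mul_lt_top ENNReal.ofReal_lt_top hz)).ne
  have hpart : ∀ m z, ‖∑ n ∈ Finset.range m, k n z‖ₑ ≤ ENNReal.ofReal D * G z := fun m z =>
    (enorm_sum_le _ _).trans ((ENNReal.sum_le_tsum _).trans (hkG z))
  have hGfin0 : ∀ᵐ z, G z < ⊤ := by
    filter_upwards [hGfin 0] with z hz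
    rwa [hGsymm, sub_zero] at hz
  have hKm : AEStronglyMeasurable (fun z => ∑' n, k n z) (volume : Measure (Space d)) := by
    refine aestronglyMeasurable_of_tendsto_ae Filter.atTop
      (f := fun m z => ∑ n ∈ Finset.range m, k n z) (fun m => ?_) ?_
    · exact (continuous_finsetSum _ fun n _ => hk n).aestronglyMeasurable
    · filter_upwards [hGfin0] with z hz
      exact (hsum z hz).hasSum.tendsto_sum_nat
  set K := hKm.mk with hKdef
  have hK : ∀ᵐ z, HasSum (fun n => k n z) (K z) := by
    filter_upwards [hGfin0, hKm.ae_eq_mk] with z hz hz'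
    rw [hKdef, ← hz']
    exact (hsum z hz).hasSum
  have hKy : ∀ y, ∀ᵐ x, HasSum (fun n => k n (y - x)) (K (y - x)) := fun y =>
    (quasiMeasurePreserving_sub_left volume y).ae hK
  have hKx : ∀ x, ∀ᵐ y, HasSum (fun n => k n (y - x)) (K (y - x)) := fun x =>
    (measurePreserving_sub_right volume x).quasiMeasurePreserving.ae hK
  refine exists_operator_of_kernel hr q K hKm.stronglyMeasurable_mk (C := D * C) (by positivity)
    (fun y => ?_) fun φ x => ?_
  · calc _ ≤ ∫⁻ x, ENNReal.ofReal D * (G (y - x) * ENNReal.ofReal ((1 + ‖x‖) ^ (-r))) := by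
          refine lintegral_mono_ae ?_
          filter_upwards [hKy y] with x hx
          rw [← mul_assoc]
          gcongr
          rw [← hx.tsum_eq]
          exact enorm_tsum_le_tsum_enorm.trans (hkG _)
      _ ≤ _ := by
          rw [lintegral_const_mul' _ _ ENNReal.ofReal_ne_top, mul_assoc, ENNReal.ofReal_mul hD]
          gcongr
          exact hG y
  · refine tendsto_nhds_unique (hmult φ x) ?_
    obtain ⟨B, hB, hφ⟩ := exists_schwartz_norm_le φ r
    -- `φ` decays at least like the weight, and `G` is even, so the weighted bound applies with the
    -- roles of `x` and `y` exchanged.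
    have hfin : ∫⁻ y, ENNReal.ofReal D * G (y - x) * ‖φ y‖ₑ < ⊤ := by
      calc _ ≤ ∫⁻ y, ENNReal.ofReal (D * B) * (G (x - y) * ENNReal.ofReal ((1 + ‖y‖) ^ (-r))) := by
            refine lintegral_mono fun y => ?_
            calc _ ≤ ENNReal.ofReal D * G (y - x) * ENNReal.ofReal (B * (1 + ‖y‖) ^ (-r)) := by
                  gcongr
                  rw [← ofReal_norm]
                  exact ENNReal.ofReal_le_ofReal (hφ y)
              _ = _ := by
                  rw [ENNReal.ofReal_mul hB, ENNReal.ofReal_mul hD, hGsymm]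
                  ring
        _ < ⊤ := by
            rw [lintegral_const_mul' _ _ ENNReal.ofReal_ne_top]
            exact ENNReal.mul_lt_top ENNReal.ofReal_lt_top
              ((hG x).trans_lt ENNReal.ofReal_lt_top)
    have hφm : Measurable fun y => ‖φ y‖ₑ := φ.continuous.measurable.enorm
    refine tendsto_integral_of_dominated_convergence
      (fun y => (ENNReal.ofReal D * G (y - x) * ‖φ y‖ₑ).toReal) (fun m => ?_) ?_ (fun m => ?_) ?_
    · refine Continuous.aestronglyMeasurable (Continuous.mul ?_ φ.continuous)
      exact continuous_finsetSum _ fun n _ => (hk n).comp (continuous_id.sub continuous_const)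
    · exact integrable_toReal_of_lintegral_ne_top
        (by fun_prop) hfin.ne
    · filter_upwards [hGfin x] with y hy
      rw [hGsymm] at hy
      rw [← toReal_enorm]
      refine ENNReal.toReal_mono
        (ENNReal.mul_lt_top (ENNReal.mul_lt_top ENNReal.ofReal_lt_top hy) enorm_lt_top).ne ?_
      rw [enorm_mul]
      gcongr
      exact hpart m _
    · filter_upwards [hKx x] with y hy
      exact hy.tendsto_sum_nat.mul_const _

/-! ### Multipliers with integrable symbols and their limits -/

/-- The inverse Fourier transform `(2π)^{-d} ∫ e^{i z·ξ} Q(ξ) dξ`. -/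
noncomputable def inverseKernel {d : ℕ} (Q : Space d → ℂ) (z : Space d) : ℂ :=
  (((2 * Real.pi) ^ d : ℝ) : ℂ)⁻¹ *
    ∫ ξ, Complex.exp (Complex.I * ((inner ℝ z ξ : ℝ) : ℂ)) * Q ξ

lemma norm_exp_I_mul (t : ℝ) : ‖Complex.exp (Complex.I * (t : ℂ))‖ = 1 := by
  rw [mul_comm, Complex.norm_exp_ofReal_mul_I]

lemma integrable_phase_mul {d : ℕ} {Q : Space d → ℂ} (hQ : Integrable Q) (z : Space d) :
    Integrable fun ξ => Complex.exp (Complex.I * ((inner ℝ z ξ : ℝ) : ℂ)) * Q ξ := by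
  refine hQ.bdd_mul (c := 1) (Continuous.aestronglyMeasurable (by fun_prop)) ?_
  exact Filter.Eventually.of_forall fun ξ => (norm_exp_I_mul _).le

lemma continuous_inverseKernel {d : ℕ} {Q : Space d → ℂ} (hQ : Integrable Q) :
    Continuous (inverseKernel Q) := by
  refine continuous_const.mul (continuous_of_dominated (bound := fun ξ => ‖Q ξ‖)
    (fun z => (integrable_phase_mul hQ z).aestronglyMeasurable) (fun z => ?_) hQ.norm ?_)
  · exact Filter.Eventually.of_forall fun ξ => by rw [norm_mul, norm_exp_I_mul, one_mul]
  · exact Filter.Eventually.of_forall fun ξ => by fun_prop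

lemma inverseKernel_add {d : ℕ} {Q R : Space d → ℂ} (hQ : Integrable Q) (hR : Integrable R)
    (z : Space d) : inverseKernel (fun ξ => Q ξ + R ξ) z = inverseKernel Q z + inverseKernel R z := by
  simp only [inverseKernel, mul_add]
  rw [integral_add (integrable_phase_mul hQ z) (integrable_phase_mul hR z), mul_add]

lemma inverseKernel_sum {d : ℕ} {Q : ℕ → Space d → ℂ} (hQ : ∀ n, Integrable (Q n))
    (s : Finset ℕ) (z : Space d) :
    inverseKernel (fun ξ => ∑ n ∈ s, Q n ξ) z = ∑ n ∈ s, inverseKernel (Q n) z := by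
  simp only [inverseKernel, Finset.mul_sum]
  rw [integral_finsetSum _ fun n _ => integrable_phase_mul (hQ n) z, Finset.mul_sum]

/-- The multiplier with an integrable symbol is a convolution. -/
lemma multiplier_neg_eq_integral {d : ℕ} {Q : Space d → ℂ} (hQ : Integrable Q)
    (φ : SchwartzMap (Space d) ℂ) (x : Space d) :
    multiplier (fun ξ => Q (-ξ)) φ x = ∫ y, inverseKernel Q (y - x) * φ y := by
  have hφ : Integrable φ := φ.integrable
  have hswap : Integrable (fun w : Space d × Space d =>
      Complex.exp (Complex.I * ((inner ℝ (w.2 - x) w.1 : ℝ) : ℂ)) * (Q w.1 * φ w.2))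
      (volume.prod volume) := by
    refine (hQ.mul_prod hφ).bdd_mul (c := 1) (Continuous.aestronglyMeasurable (by fun_prop)) ?_
    exact Filter.Eventually.of_forall fun w => (norm_exp_I_mul _).le
  unfold multiplier
  -- After `ξ ↦ -ξ` the symbol becomes `Q ξ`, and the phases combine to `e^{i(y-x)·ξ}`.
  rw [← integral_neg_eq_self]
  calc _ = (((2 * Real.pi) ^ d : ℝ) : ℂ)⁻¹ * ∫ ξ, ∫ y,
        Complex.exp (Complex.I * ((inner ℝ (y - x) ξ : ℝ) : ℂ)) * (Q ξ * φ y) := by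
        congr 1
        refine integral_congr_ae (Filter.Eventually.of_forall fun ξ => ?_)
        simp only [neg_neg, fourierTransform]
        rw [← integral_const_mul]
        refine integral_congr_ae (Filter.Eventually.of_forall fun y => ?_)
        have e : Complex.exp (Complex.I * ((inner ℝ (y - x) ξ : ℝ) : ℂ)) =
            Complex.exp (-(Complex.I * ((inner ℝ x ξ : ℝ) : ℂ))) *
              Complex.exp (Complex.I * ((inner ℝ y ξ : ℝ) : ℂ)) := by
          rw [← Complex.exp_add, inner_sub_left, Complex.ofReal_sub]
          ring_nf
        simp only [inner_neg_right, Complex.ofReal_neg, mul_neg, neg_neg]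
        rw [e]
        ring
    _ = (((2 * Real.pi) ^ d : ℝ) : ℂ)⁻¹ * ∫ y, ∫ ξ,
        Complex.exp (Complex.I * ((inner ℝ (y - x) ξ : ℝ) : ℂ)) * (Q ξ * φ y) := by
        rw [integral_integral_swap hswap]
    _ = _ := by
        rw [← integral_const_mul]
        refine integral_congr_ae (Filter.Eventually.of_forall fun y => ?_)
        simp only [inverseKernel]
        rw [mul_assoc, ← integral_mul_const]
        simp only [mul_assoc]

open scoped FourierTransform in
lemma fourierTransform_eq {d : ℕ} (f : Space d → ℂ) (ξ : Space d) :
    fourierTransform f ξ = 𝓕 f ((2 * Real.pi)⁻¹ • ξ) := by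
  rw [fourierTransform, Real.fourier_eq']
  refine integral_congr_ae (Filter.Eventually.of_forall fun x => ?_)
  simp only [inner_smul_right, smul_eq_mul]
  congr 2
  push_cast
  field_simp

open scoped FourierTransform in
lemma inverseKernel_eq {d : ℕ} (f : Space d → ℂ) (z : Space d) :
    inverseKernel f z =
      (((2 * Real.pi) ^ d : ℝ) : ℂ)⁻¹ * 𝓕 f (-((2 * Real.pi)⁻¹ • z)) := by
  rw [inverseKernel, Real.fourier_eq']
  congr 1
  refine integral_congr_ae (Filter.Eventually.of_forall fun x => ?_)
  simp only [inner_smul_right, inner_neg_right, smul_eq_mul]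
  rw [real_inner_comm]
  congr 2
  push_cast
  field_simp

lemma integrable_fourierTransform {d : ℕ} (φ : SchwartzMap (Space d) ℂ) :
    Integrable (fourierTransform φ) := by
  have h : (fourierTransform φ) = fun ξ => (FourierTransform.fourier φ)
      ((2 * Real.pi)⁻¹ • ξ) := by
    funext ξ
    rw [fourierTransform_eq, SchwartzMap.fourier_coe]
  rw [h]
  exact (SchwartzMap.integrable (μ := volume) _).comp_smul (by positivity)

/-- Dominated convergence with majorant `B |φ̂|`. Since `d ≥ 1`, the origin is a null set and the
symbols are not constrained there. -/
lemma tendsto_multiplier {d : ℕ} (hd : 1 ≤ d) {Q : ℕ → Space d → ℂ} {q : Space d → ℂ}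
    (hQm : ∀ n, AEStronglyMeasurable (Q n) volume) {B : ℝ}
    (hB : ∀ n ξ, ξ ≠ 0 → ‖Q n ξ‖ ≤ B)
    (hlim : ∀ ξ, ξ ≠ 0 → Filter.Tendsto (fun n => Q n ξ) Filter.atTop (nhds (q ξ)))
    (φ : SchwartzMap (Space d) ℂ) (x : Space d) :
    Filter.Tendsto (fun n => multiplier (fun ξ => Q n (-ξ)) φ x) Filter.atTop
      (nhds (multiplier (fun ξ => q (-ξ)) φ x)) := by
  have : Nonempty (Fin d) := ⟨⟨0, hd⟩⟩
  have hφ := integrable_fourierTransform φ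
  have hne : ∀ᵐ ξ : Space d, ξ ≠ 0 := Measure.ae_ne volume 0
  refine Filter.Tendsto.const_mul _ (tendsto_integral_of_dominated_convergence
    (fun ξ => B * ‖fourierTransform φ ξ‖) (fun n => ?_) (hφ.norm.const_mul B) (fun n => ?_) ?_)
  · refine (AEStronglyMeasurable.mul (Continuous.aestronglyMeasurable (by fun_prop)) ?_).mul
      hφ.aestronglyMeasurable
    exact (hQm n).comp_quasiMeasurePreserving
      (Measure.measurePreserving_neg volume).quasiMeasurePreserving
  · filter_upwards [hne] with ξ hξ
    rw [norm_mul, norm_mul, norm_exp_I_mul, one_mul]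
    gcongr
    exact hB n _ (neg_ne_zero.2 hξ)
  · filter_upwards [hne] with ξ hξ
    exact ((hlim _ (neg_ne_zero.2 hξ)).const_mul _).mul_const _

/-! ### Kernel decay from symbol smoothness -/

/-- Integration by parts: `|w|^N |â(w)|` is controlled by `L^1` norms of derivatives, each at most
`B` times the volume of the supporting ball. The constant does not depend on `a`, so it serves all
dyadic blocks at once. -/
lemma one_add_norm_pow_mul_fourier_le {d : ℕ} (N : ℕ) :
    ∃ C : ℝ, 0 ≤ C ∧ ∀ (a : Space d → ℂ) (B : ℝ), ContDiff ℝ ((⊤ : ℕ∞) : WithTop ℕ∞) a →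
      (∀ x, 2 < ‖x‖ → a x = 0) → (∀ j ≤ N, ∀ x, ‖iteratedFDeriv ℝ j a x‖ ≤ B) →
      ∀ z, ‖inverseKernel a z‖ ≤ C * B * ((1 + ‖z‖) ^ N)⁻¹ := by
  set V := volume.real (Metric.closedBall (0 : Space d) 2) with hV
  set E : ℝ := (2 * Real.pi) ^ N * (2 ^ (N - 1) * (V + 2 ^ N * ((N + 1 : ℕ) * V))) with hE
  refine ⟨((2 * Real.pi) ^ d)⁻¹ * E, by positivity, fun a B ha hsupp hB z => ?_⟩
  have hB0 : 0 ≤ B := (norm_nonneg _).trans (hB 0 (Nat.zero_le _) 0)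
  have htsupp : tsupport a ⊆ Metric.closedBall 0 2 := by
    refine closure_minimal (fun x hx => ?_) Metric.isClosed_closedBall
    by_contra h
    exact hx (hsupp x (by simpa using h))
  have hcs : HasCompactSupport a :=
    (isCompact_closedBall (0 : Space d) 2).of_isClosed_subset (isClosed_tsupport a) htsupp
  have hder : ∀ j ≤ N, ∫ v, ‖iteratedFDeriv ℝ j a v‖ ≤ V * B := by
    intro j hj
    have hz : ∀ v ∉ Metric.closedBall (0 : Space d) 2, ‖iteratedFDeriv ℝ j a v‖ = 0 := by
      intro v hv
      rw [norm_eq_zero]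
      by_contra h
      exact hv (htsupp (support_iteratedFDeriv_subset j h))
    rw [← setIntegral_eq_integral_of_forall_compl_eq_zero hz]
    have hle := norm_setIntegral_le_of_norm_le_const (μ := volume)
      (s := Metric.closedBall (0 : Space d) 2) (f := fun v => ‖iteratedFDeriv ℝ j a v‖) (C := B)
      measure_closedBall_lt_top (fun v _ => by rw [norm_norm]; exact hB j hj v)
    rw [mul_comm]
    exact (le_abs_self _).trans hle
  have hint : ∀ k n : ℕ, Integrable fun v => ‖v‖ ^ k * ‖iteratedFDeriv ℝ n a v‖ := by
    intro k n
    refine Continuous.integrable_of_hasCompactSupport ?_ ?_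
    · exact (continuous_norm.pow k).mul (ha.continuous_iteratedFDeriv (by exact_mod_cast le_top)).norm
    · exact ((hcs.iteratedFDeriv n).norm).mul_left
  set w : Space d := -((2 * Real.pi)⁻¹ • z) with hw
  have hFN : ∀ n ≤ N, ‖w‖ ^ n * ‖FourierTransform.fourier a w‖ ≤
      2 ^ n * ((n + 1 : ℕ) * (V * B)) := by
    intro n hn
    have h := Real.pow_mul_norm_iteratedFDeriv_fourier_le (K := ⊤) (N := ⊤) ha
      (fun k n _ _ => hint k n) (k := 0) (n := n) le_top le_top w
    rw [norm_iteratedFDeriv_zero] at h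
    refine h.trans ?_
    simp only [pow_zero, Nat.cast_zero, mul_zero, zero_add, one_mul]
    gcongr
    rw [Finset.sum_product]
    simp only [Finset.range_one, Finset.sum_singleton, pow_zero, one_mul]
    calc _ ≤ ∑ _j ∈ Finset.range (n + 1), V * B :=
          Finset.sum_le_sum fun j hj => hder j (by have := Finset.mem_range.1 hj; omega)
      _ = _ := by simp
  have h0 := hFN 0 (Nat.zero_le _)
  have hN := hFN N le_rfl
  simp only [pow_zero, one_mul, zero_add, Nat.cast_one] at h0
  have hzw : 1 + ‖z‖ ≤ 2 * Real.pi * (1 + ‖w‖) := by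
    have hnw : ‖w‖ = (2 * Real.pi)⁻¹ * ‖z‖ := by
      rw [hw, norm_neg, norm_smul, Real.norm_of_nonneg (by positivity)]
    have : 2 * Real.pi * ‖w‖ = ‖z‖ := by
      rw [hnw]
      field_simp
    have := Real.pi_gt_three
    linarith
  have hmain : (1 + ‖z‖) ^ N * ‖FourierTransform.fourier a w‖ ≤ E * B := by
    calc _ ≤ (2 * Real.pi * (1 + ‖w‖)) ^ N * ‖FourierTransform.fourier a w‖ := by gcongr
      _ ≤ ((2 * Real.pi) ^ N * (2 ^ (N - 1) * (1 ^ N + ‖w‖ ^ N))) *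
            ‖FourierTransform.fourier a w‖ := by
          rw [mul_pow]
          gcongr
          exact add_pow_le zero_le_one (norm_nonneg w) N
      _ = (2 * Real.pi) ^ N * (2 ^ (N - 1) * (‖FourierTransform.fourier a w‖ +
            ‖w‖ ^ N * ‖FourierTransform.fourier a w‖)) := by ring
      _ ≤ (2 * Real.pi) ^ N * (2 ^ (N - 1) * (V * B + 2 ^ N * ((N + 1 : ℕ) * (V * B)))) := by
          gcongr
      _ = _ := by
          rw [hE]
          ring
  rw [inverseKernel_eq, norm_mul, norm_inv, Complex.norm_real, Real.norm_of_nonneg (by positivity),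
    mul_assoc, mul_assoc]
  gcongr
  rw [← mul_assoc, ← div_eq_mul_inv, le_div_iff₀ (by positivity), mul_comm]
  exact hmain

lemma inverseKernel_comp_smul {d : ℕ} (a : Space d → ℂ) {t : ℝ} (ht : 0 < t) (z : Space d) :
    inverseKernel (fun ξ => a (t • ξ)) z =
      ((t⁻¹ ^ d : ℝ) : ℂ) * inverseKernel a (t⁻¹ • z) := by
  have h := Measure.integral_comp_smul (volume : Measure (Space d))
    (fun η => Complex.exp (Complex.I * ((inner ℝ (t⁻¹ • z) η : ℝ) : ℂ)) * a η) t
  have e : ∀ ξ : Space d, inner ℝ (t⁻¹ • z) (t • ξ) = inner ℝ z ξ := fun ξ => by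
    rw [real_inner_smul_left, real_inner_smul_right, inv_mul_cancel_left₀ ht.ne']
  simp only [e, finrank_euclideanSpace_fin] at h
  rw [inverseKernel, h, inverseKernel, abs_of_pos (by positivity), Complex.real_smul, inv_pow]
  ring

lemma norm_inverseKernel_comp_smul_le {d N : ℕ} {a : Space d → ℂ} {B : ℝ}
    (h : ∀ z, ‖inverseKernel a z‖ ≤ B * ((1 + ‖z‖) ^ N)⁻¹) {t : ℝ} (ht : 0 < t) (z : Space d) :
    ‖inverseKernel (fun ξ => a (t • ξ)) z‖ ≤ B * profile d N t⁻¹ z := by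
  rw [inverseKernel_comp_smul a ht, norm_mul, Complex.norm_real,
    Real.norm_of_nonneg (by positivity)]
  calc _ ≤ t⁻¹ ^ d * (B * ((1 + ‖t⁻¹ • z‖) ^ N)⁻¹) := by
        gcongr
        exact h _
    _ = _ := by
        rw [norm_smul, Real.norm_of_nonneg (by positivity), profile]
        ring

/-! ### Uniform bounds for the rescaled symbols -/

lemma exists_bound_iteratedFDerivWithin {E F : Type*} [NormedAddCommGroup E] [NormedSpace ℝ E]
    [NormedAddCommGroup F] [NormedSpace ℝ F] {f : E → F} {U A : Set E} (hU : IsOpen U)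
    (hA : IsCompact A) (hAU : A ⊆ U) (hf : ContDiffOn ℝ ((⊤ : ℕ∞) : WithTop ℕ∞) f U) (N : ℕ) :
    ∃ B : ℝ, 0 ≤ B ∧ ∀ i ≤ N, ∀ x ∈ A, ‖iteratedFDerivWithin ℝ i f U x‖ ≤ B := by
  have h : ∀ i : ℕ, ∃ B : ℝ, ∀ x ∈ A, ‖iteratedFDerivWithin ℝ i f U x‖ ≤ B := fun i =>
    hA.exists_bound_of_continuousOn
      ((hf.continuousOn_iteratedFDerivWithin (by exact_mod_cast le_top) hU.uniqueDiffOn).mono hAU)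
  choose B hB using h
  refine ⟨∑ i ∈ Finset.range (N + 1), |B i|, by positivity, fun i hi x hx => ?_⟩
  calc _ ≤ |B i| := (hB i x hx).trans (le_abs_self _)
    _ ≤ _ := Finset.single_le_sum (f := fun i => |B i|) (fun i _ => abs_nonneg _)
      (Finset.mem_range.2 (by omega))

/-- Uniform bounds for the derivatives of quotients in terms of bounds for the denominator. -/
lemma exists_bound_iteratedFDerivWithin_mul_inv {E : Type*} [NormedAddCommGroup E]
    [NormedSpace ℝ E] {ψ : E → ℂ} {U A : Set E} (hU : IsOpen U) (hA : IsCompact A) (hAU : A ⊆ U)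
    (hψ : ContDiffOn ℝ ((⊤ : ℕ∞) : WithTop ℕ∞) ψ U) (N : ℕ) {c : ℝ} (hc : 0 < c) (B : ℝ) :
    ∃ B' : ℝ, 0 ≤ B' ∧ ∀ g : E → ℂ, ContDiffOn ℝ ((⊤ : ℕ∞) : WithTop ℕ∞) g U →
      (∀ x ∈ U, g x ≠ 0) → (∀ x ∈ A, c ≤ ‖g x‖) →
      (∀ i ≤ N, ∀ x ∈ A, ‖iteratedFDerivWithin ℝ i g U x‖ ≤ B) →
      ∀ i ≤ N, ∀ x ∈ A, ‖iteratedFDerivWithin ℝ i (fun y => ψ y * (g y)⁻¹) U x‖ ≤ B' := by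
  have hV : IsOpen ({0}ᶜ : Set ℂ) := isOpen_compl_singleton
  -- The values of `g` on `A` lie in this compact annulus, where all derivatives of inversion up to
  -- order `N` are bounded.
  set Z : Set ℂ := Metric.closedBall 0 B \ Metric.ball 0 c with hZ
  have hZc : IsCompact Z := (isCompact_closedBall _ _).diff Metric.isOpen_ball
  have hZV : Z ⊆ {0}ᶜ := by
    rintro z ⟨_, hz⟩ rfl
    exact hz (by simpa using hc)
  obtain ⟨B₁, hB₁, h₁⟩ := exists_bound_iteratedFDerivWithin hV hZc hZV
    (contDiffOn_inv ℝ (𝕜' := ℂ)) N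
  obtain ⟨B₂, hB₂, h₂⟩ := exists_bound_iteratedFDerivWithin hU hA hAU hψ N
  -- The chain-rule estimate wants the `k`-th derivative of `g` bounded by a `k`-th power; `R ≥ 1`
  -- gives `B ≤ R ^ k` for `k ≥ 1`.
  set R : ℝ := max 1 B with hR
  have hR1 : 1 ≤ R := le_max_left _ _
  set S : ℝ := N.factorial * B₁ * R ^ N with hS
  refine ⟨2 ^ N * B₂ * S, by positivity, fun g hg hg0 hgc hgB i hi x hx => ?_⟩
  have hinvg : ContDiffOn ℝ ((⊤ : ℕ∞) : WithTop ℕ∞) (fun y => (g y)⁻¹) U := fun y hy =>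
    (hg y hy).fun_inv (hg0 y hy)
  have hgx : g x ∈ Z := by
    refine ⟨?_, ?_⟩
    · have := hgB 0 (Nat.zero_le _) x hx
      rw [norm_iteratedFDerivWithin_zero] at this
      simpa using this
    · simpa using hgc x hx
  have hcomp : ∀ l ≤ N, ‖iteratedFDerivWithin ℝ l (fun y => (g y)⁻¹) U x‖ ≤ S := by
    intro l hl
    have h := norm_iteratedFDerivWithin_comp_le (n := l) (x := x) (contDiffOn_inv ℝ (𝕜' := ℂ)) hg
      (by exact_mod_cast le_top) hV.uniqueDiffOn hU.uniqueDiffOn (fun y hy => hg0 y hy) (hAU hx)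
      (C := B₁) (D := R) (fun k hk => h₁ k (hk.trans hl) _ hgx) (fun k hk1 hk => by
        calc _ ≤ B := hgB k (hk.trans hl) x hx
          _ ≤ R := le_max_right _ _
          _ ≤ R ^ k := le_self_pow₀ hR1 (by omega))
    refine h.trans ?_
    rw [hS]
    gcongr
  calc _ ≤ ∑ l ∈ Finset.range (i + 1), (i.choose l : ℝ) * ‖iteratedFDerivWithin ℝ l ψ U x‖ *
        ‖iteratedFDerivWithin ℝ (i - l) (fun y => (g y)⁻¹) U x‖ :=
        norm_iteratedFDerivWithin_mul_le hψ hinvg hU.uniqueDiffOn (hAU hx)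
          (by exact_mod_cast le_top)
    _ ≤ ∑ l ∈ Finset.range (i + 1), (i.choose l : ℝ) * B₂ * S := by
        refine Finset.sum_le_sum fun l hl => ?_
        have hl' := Finset.mem_range.1 hl
        gcongr
        · exact h₂ l (by omega) x hx
        · exact hcomp _ (by omega)
    _ = 2 ^ i * B₂ * S := by
        rw [← Finset.sum_mul, ← Finset.sum_mul]
        congr 2
        exact_mod_cast Nat.sum_range_choose i
    _ ≤ _ := by
        have : 0 ≤ S := by positivity
        gcongr
        norm_num

lemma rpow_le_max_one_rpow {ρ a M : ℝ} (hρ : 0 < ρ) (ha : 0 ≤ a) (haM : a ≤ M) :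
    ρ ^ a ≤ max 1 (ρ ^ M) := by
  rcases le_or_gt ρ 1 with h | h
  · exact (Real.rpow_le_one hρ.le h ha).trans (le_max_left _ _)
  · exact (Real.rpow_le_rpow_of_exponent_le h.le haM).trans (le_max_right _ _)

lemma max_one_rpow_le_bracket {d : ℕ} {ρ M : ℝ} (hρ : 0 < ρ) (hM : 0 ≤ M) {x : Space d}
    (hx : 1 / 2 ≤ ‖x‖) : 2 ^ (-M) * max 1 (ρ ^ M) ≤ bracket (ρ • x) ^ M := by
  have h1 := one_le_bracket (ρ • x)
  have h2 := norm_le_bracket (ρ • x)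
  rw [norm_smul, Real.norm_of_nonneg hρ.le] at h2
  rw [Real.rpow_neg (by norm_num), inv_mul_le_iff₀ (by positivity),
    ← Real.mul_rpow (by norm_num) (by linarith)]
  refine max_le (Real.one_le_rpow (by linarith) hM) ?_
  exact Real.rpow_le_rpow hρ.le (by nlinarith) hM

/-- The localised and rescaled symbols `ψ(η) / p(η / t)` are bounded in `C^N`, uniformly in `t`. -/
theorem exists_symbol_bound {d h : ℕ} {m : Fin (h + 1) → ℝ} (hm0 : m 0 = 0) (hm : StrictMono m)
    {P : Fin (h + 1) → Space d → ℂ}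
    (hsmooth : ∀ j, ContDiffOn ℝ ((⊤ : ℕ∞) : WithTop ℕ∞) (P j) {0}ᶜ)
    (hhom : ∀ j, ∀ t : ℝ, 0 < t → ∀ ξ : Space d, ξ ≠ 0 →
      P j (t • ξ) = ((t ^ m j : ℝ) : ℂ) * P j ξ)
    {p : Space d → ℂ} (hp : ∀ ξ, ξ ≠ 0 → p ξ = ∑ j, P j ξ) {c : ℝ} (hc : 0 < c)
    (hell : ∀ ξ : Space d, ξ ≠ 0 → c * bracket ξ ^ m (Fin.last h) ≤ ‖p ξ‖)
    {ψ : Space d → ℂ} (hψ : ContDiff ℝ ((⊤ : ℕ∞) : WithTop ℕ∞) ψ)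
    (hψs : ∀ x, ψ x ≠ 0 → 1 / 2 ≤ ‖x‖ ∧ ‖x‖ ≤ 2) (N : ℕ) :
    ∃ B : ℝ, 0 ≤ B ∧ ∀ t : ℝ, 0 < t →
      ContDiff ℝ ((⊤ : ℕ∞) : WithTop ℕ∞) (fun η => ψ η * (p (t⁻¹ • η))⁻¹) ∧
      ∀ j ≤ N, ∀ η, ‖iteratedFDeriv ℝ j (fun η => ψ η * (p (t⁻¹ • η))⁻¹) η‖ ≤
        B * min 1 (t ^ m (Fin.last h)) := by
  set M := m (Fin.last h) with hMdef
  have hmj0 : ∀ j, 0 ≤ m j := fun j => hm0 ▸ hm.monotone (Fin.zero_le j)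
  have hmjM : ∀ j, m j ≤ M := fun j => hm.monotone (Fin.le_last j)
  have hM0 : 0 ≤ M := hmj0 _
  set U : Set (Space d) := {0}ᶜ with hUdef
  have hU : IsOpen U := isOpen_compl_singleton
  set A : Set (Space d) := Metric.closedBall 0 2 \ Metric.ball 0 (1 / 2) with hAdef
  have hA : IsCompact A := (isCompact_closedBall _ _).diff Metric.isOpen_ball
  have hmemA : ∀ x, x ∈ A ↔ 1 / 2 ≤ ‖x‖ ∧ ‖x‖ ≤ 2 := fun x => by
    simp [hAdef, and_comm]
  have hAU : A ⊆ U := by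
    intro x hx h0
    rw [Set.mem_singleton_iff] at h0
    have := ((hmemA x).1 hx).1
    rw [h0, norm_zero] at this
    norm_num at this
  choose B hB0 hB using fun j => exists_bound_iteratedFDerivWithin hU hA hAU (hsmooth j) N
  obtain ⟨B', hB'0, hB'⟩ := exists_bound_iteratedFDerivWithin_mul_inv hU hA hAU hψ.contDiffOn N
    (c := c * 2 ^ (-M)) (by positivity) (∑ j, B j)
  refine ⟨B', hB'0, fun t ht => ?_⟩
  set ρ := t⁻¹ with hρdef
  have hρ : 0 < ρ := inv_pos.2 ht
  -- `μ` is the size of `p` at frequency `ρ = 1/t`. As `0 ≤ m j ≤ M`, each coefficient `ρ ^ m j / μ`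
  -- is at most `1`, so `g` is bounded in `C^N` on `A` uniformly in `t`; the factor `μ⁻¹` becomes
  -- the gain `min 1 (t ^ M)`.
  set μ : ℝ := max 1 (ρ ^ M) with hμdef
  have hμ1 : 1 ≤ μ := le_max_left _ _
  have hμ0 : 0 < μ := by linarith
  have hμt : μ⁻¹ = min 1 (t ^ M) := by
    rw [hμdef, hρdef, Real.inv_rpow ht.le]
    have htM : 0 < t ^ M := by positivity
    rcases le_total (t ^ M) 1 with h | h
    · rw [min_eq_right h, max_eq_right ((one_le_inv₀ htM).2 h), inv_inv]
    · rw [min_eq_left h, max_eq_left (inv_le_one_of_one_le₀ h), inv_one]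
  set g : Space d → ℂ := ∑ j, (ρ ^ m j / μ) • P j with hg
  have hgU : ∀ x ∈ U, p (ρ • x) = (μ : ℂ) * g x := by
    intro x hx
    have hx0 : x ≠ 0 := hx
    rw [hp _ (smul_ne_zero hρ.ne' hx0), hg, Finset.sum_apply, Finset.mul_sum]
    refine Finset.sum_congr rfl fun j _ => ?_
    rw [hhom j ρ hρ x hx0, Pi.smul_apply, Complex.real_smul]
    have : (μ : ℂ) ≠ 0 := by exact_mod_cast hμ0.ne'
    push_cast
    field_simp
  have hgsm : ContDiffOn ℝ ((⊤ : ℕ∞) : WithTop ℕ∞) g U := by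
    have : g = fun x => ∑ j, (ρ ^ m j / μ) • P j x := by
      funext x
      simp [hg]
    rw [this]
    exact ContDiffOn.sum fun j _ => (hsmooth j).const_smul _
  have hpne : ∀ x ∈ U, p (ρ • x) ≠ 0 := by
    intro x hx
    have h1 := hell _ (smul_ne_zero hρ.ne' hx)
    have h2 := one_le_bracket (ρ • x)
    have h3 : 0 < c * bracket (ρ • x) ^ M := by positivity
    exact norm_pos_iff.1 (h3.trans_le h1)
  have hgne : ∀ x ∈ U, g x ≠ 0 := fun x hx h0 => hpne x hx (by rw [hgU x hx, h0, mul_zero])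
  have hglow : ∀ x ∈ A, c * 2 ^ (-M) ≤ ‖g x‖ := by
    intro x hx
    have h1 := hell _ (smul_ne_zero hρ.ne' (hAU hx))
    have h2 := max_one_rpow_le_bracket hρ hM0 ((hmemA x).1 hx).1
    rw [hgU x (hAU hx), norm_mul, Complex.norm_real, Real.norm_of_nonneg hμ0.le] at h1
    have h3 : μ * (c * 2 ^ (-M)) ≤ μ * ‖g x‖ := by
      calc _ = c * (2 ^ (-M) * μ) := by ring
        _ ≤ c * bracket (ρ • x) ^ M := by gcongr
        _ ≤ _ := h1
    exact le_of_mul_le_mul_left h3 hμ0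
  have hgB : ∀ i ≤ N, ∀ x ∈ A, ‖iteratedFDerivWithin ℝ i g U x‖ ≤ ∑ j, B j := by
    intro i hi x hx
    have hsm : ∀ j, ContDiffWithinAt ℝ i (P j) U x := fun j =>
      ((hsmooth j).of_le (by exact_mod_cast le_top)) x (hAU hx)
    have hsm' : ∀ j ∈ Finset.univ, ContDiffWithinAt ℝ i ((ρ ^ m j / μ) • P j) U x := fun j _ => by
      exact contDiffWithinAt_const.smul (hsm j)
    rw [hg, iteratedFDerivWithin_sum_apply hU.uniqueDiffOn (hAU hx) hsm']
    refine (norm_sum_le _ _).trans (Finset.sum_le_sum fun j _ => ?_)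
    rw [iteratedFDerivWithin_const_smul_apply (hsm j) hU.uniqueDiffOn (hAU hx), norm_smul,
      Real.norm_of_nonneg (by positivity)]
    calc _ ≤ 1 * B j := by
          gcongr
          · exact div_le_one_of_le₀ (rpow_le_max_one_rpow hρ (hmj0 j) (hmjM j)) hμ0.le
          · exact hB j i hi x hx
      _ = _ := one_mul _
  have hmain := hB' g hgsm hgne hglow hgB
  set a : Space d → ℂ := fun η => ψ η * (p (ρ • η))⁻¹ with ha
  have haU : Set.EqOn a (μ⁻¹ • fun y => ψ y * (g y)⁻¹) U := by
    intro x hx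
    simp only [ha, Pi.smul_apply, Complex.real_smul]
    rw [hgU x hx, mul_inv]
    push_cast
    ring
  have hquot : ContDiffOn ℝ ((⊤ : ℕ∞) : WithTop ℕ∞) (fun y => ψ y * (g y)⁻¹) U := fun x hx =>
    hψ.contDiffWithinAt.mul ((hgsm x hx).fun_inv (hgne x hx))
  have haUs : ContDiffOn ℝ ((⊤ : ℕ∞) : WithTop ℕ∞) a U := (hquot.const_smul μ⁻¹).congr haU
  have hazero : ∀ x, x ∉ A → a x = 0 := by
    intro x hx
    have : ψ x = 0 := by
      by_contra h0
      exact hx ((hmemA x).2 (hψs x h0))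
    simp [ha, this]
  have hsmooth_a : ContDiff ℝ ((⊤ : ℕ∞) : WithTop ℕ∞) a := by
    rw [contDiff_iff_contDiffAt]
    intro x
    by_cases hx : x = 0
    · have hev : a =ᶠ[nhds x] fun _ => 0 := by
        filter_upwards [Metric.isOpen_ball.mem_nhds
          (show x ∈ Metric.ball (0 : Space d) (1 / 2) by rw [hx]; simp)] with y hy
        exact hazero y fun h => h.2 hy
      exact contDiffAt_const.congr_of_eventuallyEq hev
    · exact (haUs x hx).contDiffAt (hU.mem_nhds hx)
  refine ⟨hsmooth_a, fun j hj η => ?_⟩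
  by_cases hη : η ∈ A
  · rw [← iteratedFDerivWithin_of_isOpen j hU (hAU hη),
      iteratedFDerivWithin_congr haU (hAU hη),
      iteratedFDerivWithin_const_smul_apply
        ((hquot.of_le (by exact_mod_cast le_top)) η (hAU hη)) hU.uniqueDiffOn (hAU hη),
      norm_smul, Real.norm_of_nonneg (by positivity), hμt, mul_comm]
    gcongr
    exact hmain j hj η hη
  · have hts : tsupport a ⊆ A := by
      refine closure_minimal (fun x hx => ?_) hA.isClosed
      by_contra h0
      exact hx (hazero x h0)
    have : iteratedFDeriv ℝ j a η = 0 := by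
      by_contra h0
      exact hη (hts (support_iteratedFDeriv_subset j h0))
    rw [this, norm_zero]
    positivity

/-! ### Dyadic partition of unity -/

/-- A smooth cutoff: `1` on the unit ball and `0` outside the ball of radius `2`. -/
noncomputable def cutoff (d : ℕ) : ContDiffBump (0 : Space d) where
  rIn := 1
  rOut := 2
  rIn_pos := one_pos
  rIn_lt_rOut := one_lt_two

lemma cutoff_eq_one {d : ℕ} {x : Space d} (hx : ‖x‖ ≤ 1) : cutoff d x = 1 :=
  (cutoff d).one_of_mem_closedBall (by simpa [cutoff] using hx)

lemma cutoff_eq_zero {d : ℕ} {x : Space d} (hx : 2 ≤ ‖x‖) : cutoff d x = 0 :=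
  (cutoff d).zero_of_le_dist (by simpa [cutoff] using hx)

/-- The dyadic annular cutoff. -/
noncomputable def annular (d : ℕ) (x : Space d) : ℂ :=
  ((cutoff d x - cutoff d ((2 : ℝ) • x) : ℝ) : ℂ)

lemma contDiff_annular {d : ℕ} : ContDiff ℝ ((⊤ : ℕ∞) : WithTop ℕ∞) (annular d) := by
  refine Complex.ofRealCLM.contDiff.comp ?_
  exact (cutoff d).contDiff.sub ((cutoff d).contDiff.comp (contDiff_const_smul 2))

lemma annular_support {d : ℕ} (x : Space d) (hx : annular d x ≠ 0) : 1 / 2 ≤ ‖x‖ ∧ ‖x‖ ≤ 2 := by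
  have h2 : ‖(2 : ℝ) • x‖ = 2 * ‖x‖ := by simp [norm_smul]
  constructor
  · by_contra! h
    refine hx ?_
    rw [annular, cutoff_eq_one (by linarith), cutoff_eq_one (by rw [h2]; linarith)]
    simp
  · by_contra! h
    refine hx ?_
    rw [annular, cutoff_eq_zero h.le, cutoff_eq_zero (by rw [h2]; linarith)]
    simp

/-- The dilations `2^k` and `2^{-(k+1)}` run through each dyadic scale once, so the sum telescopes
at both ends. -/
lemma sum_annular {d : ℕ} (n : ℕ) (ξ : Space d) :
    ∑ k ∈ Finset.range n, (annular d ((2 : ℝ) ^ k • ξ) + annular d (((2 : ℝ) ^ (k + 1))⁻¹ • ξ)) =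
      ((cutoff d (((2 : ℝ) ^ n)⁻¹ • ξ) - cutoff d ((2 : ℝ) ^ n • ξ) : ℝ) : ℂ) := by
  induction n with
  | zero => simp
  | succ n ih =>
    have e1 : (2 : ℝ) • ((2 : ℝ) ^ n • ξ) = (2 : ℝ) ^ (n + 1) • ξ := by
      rw [smul_smul, pow_succ']
    have e2 : (2 : ℝ) • (((2 : ℝ) ^ (n + 1))⁻¹ • ξ) = ((2 : ℝ) ^ n)⁻¹ • ξ := by
      rw [smul_smul, pow_succ']
      congr 1
      field_simp
    rw [Finset.sum_range_succ, ih, annular, annular, e1, e2]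
    push_cast
    ring

/-- The sequence is eventually constant: for large `n` the first cutoff equals `1` and the second
`0`. -/
lemma tendsto_cutoff_sub {d : ℕ} {ξ : Space d} (hξ : ξ ≠ 0) :
    Filter.Tendsto
      (fun n : ℕ => ((cutoff d (((2 : ℝ) ^ n)⁻¹ • ξ) - cutoff d ((2 : ℝ) ^ n • ξ) : ℝ) : ℂ))
      Filter.atTop (nhds 1) := by
  have hpos : 0 < ‖ξ‖ := norm_pos_iff.2 hξ
  have htop : Filter.Tendsto (fun n : ℕ => (2 : ℝ) ^ n) Filter.atTop Filter.atTop :=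
    tendsto_pow_atTop_atTop_of_one_lt one_lt_two
  refine tendsto_const_nhds.congr' ?_
  filter_upwards [htop.eventually_ge_atTop ‖ξ‖, htop.eventually_ge_atTop (2 / ‖ξ‖)] with n h1 h2
  have h3 : (0 : ℝ) < 2 ^ n := by positivity
  rw [cutoff_eq_one, cutoff_eq_zero]
  · simp
  · rw [norm_smul, Real.norm_of_nonneg h3.le]
    rwa [div_le_iff₀ hpos] at h2
  · rw [norm_smul, Real.norm_of_nonneg (by positivity), inv_mul_le_iff₀ h3, mul_one]
    exact h1

end WeightedMultiplier

/-! ### Assembly -/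

theorem proposition2p5
    (d : ℕ) (hd : 1 ≤ d)
    (h : ℕ) (hh : 1 ≤ h)
    (m : Fin (h + 1) → ℝ) (hm0 : m 0 = 0) (hm : StrictMono m)
    (P : Fin (h + 1) → WeightedMultiplier.Space d → ℂ)
    (hsmooth : ∀ j, ContDiffOn ℝ ((⊤ : ℕ∞) : WithTop ℕ∞) (P j) {0}ᶜ)
    (hhom : ∀ j, ∀ t : ℝ, 0 < t → ∀ ξ : WeightedMultiplier.Space d, ξ ≠ 0 →
      P j (t • ξ) = ((t ^ m j : ℝ) : ℂ) * P j ξ)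
    (p : WeightedMultiplier.Space d → ℂ)
    (hp : ∀ ξ, ξ ≠ 0 → p ξ = ∑ j, P j ξ)
    (hell : ∃ c : ℝ, 0 < c ∧ ∀ ξ : WeightedMultiplier.Space d, ξ ≠ 0 →
      c * WeightedMultiplier.bracket ξ ^ m (Fin.last h) ≤ ‖p ξ‖)
    (r : ℝ) (hr : 0 < r) :
    ∃ T : WeightedMultiplier.LinfWeighted (WeightedMultiplier.weightV d r) →ₗ[ℂ]
        WeightedMultiplier.LinfWeighted (WeightedMultiplier.weightW d r),
      (∀ f : WeightedMultiplier.LinfWeighted (WeightedMultiplier.weightV d r),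
        WeightedMultiplier.IsMultiplierImage (fun ξ => (p ξ)⁻¹) (f.1 : _ → ℂ) ((T f).1 : _ → ℂ)) ∧
      ∃ C : ℝ, ∀ f : WeightedMultiplier.LinfWeighted (WeightedMultiplier.weightV d r),
        WeightedMultiplier.weightedNorm (WeightedMultiplier.weightW d r) (T f).1 ≤
          C * WeightedMultiplier.weightedNorm (WeightedMultiplier.weightV d r) f.1 := by
  open WeightedMultiplier in
  obtain ⟨c, hc, hell⟩ := hell
  set M := m (Fin.last h) with hM
  have hM0 : 0 < M := by
    rw [hM, ← hm0]
    exact hm (Fin.lt_def.2 (by simp; omega))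
  obtain ⟨N, hN⟩ : ∃ N : ℕ, (d : ℝ) + r + 1 < N := exists_nat_gt _
  have hN1 : d + 1 ≤ N := by
    have : (d : ℝ) + 1 < N := by linarith
    exact_mod_cast this.le
  obtain ⟨B, hB, hsymb⟩ := exists_symbol_bound hm0 hm hsmooth hhom hp hc hell contDiff_annular
    annular_support N
  obtain ⟨C, hC, hdecay⟩ := one_add_norm_pow_mul_fourier_le (d := d) N
  let a : ℝ → Space d → ℂ := fun t η => annular d η * (p (t⁻¹ • η))⁻¹
  -- `b t` is `1/p` localised to `|ξ| ~ 1/t`, written as a dilate of `a t`, whose support stays in a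
  -- fixed annulus.
  let b : ℝ → Space d → ℂ := fun t ξ => a t (t • ξ)
  have hb_eq : ∀ t, 0 < t → ∀ ξ, b t ξ = annular d (t • ξ) * (p ξ)⁻¹ := by
    intro t ht ξ
    simp only [b, a]
    rw [inv_smul_smul₀ ht.ne']
  have ha_supp : ∀ t x, 2 < ‖x‖ → a t x = 0 := by
    intro t x hx
    have : annular d x = 0 := by
      by_contra h0
      linarith [(annular_support x h0).2]
    simp [a, this]
  have hb_int : ∀ t, 0 < t → Integrable (b t) := by
    intro t ht
    refine Integrable.comp_smul (f := a t) ?_ ht.ne'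
    refine (hsymb t ht).1.continuous.integrable_of_hasCompactSupport ?_
    refine HasCompactSupport.intro (isCompact_closedBall (0 : Space d) 2) fun x hx => ?_
    exact ha_supp t x (by simpa using hx)
  have hb_dec : ∀ t, 0 < t → ∀ z, ‖inverseKernel (b t) z‖ ≤
      C * (B * min 1 (t ^ M)) * profile d N t⁻¹ z := fun t ht z =>
    norm_inverseKernel_comp_smul_le
      (hdecay (a t) _ (hsymb t ht).1 (ha_supp t) (hsymb t ht).2) ht z
  have h2 : ∀ n : ℕ, (0 : ℝ) < 2 ^ n := fun n => by positivity
  have h2' : ∀ n : ℕ, (0 : ℝ) < (2 ^ (n + 1))⁻¹ := fun n => by positivity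
  -- Pairing frequencies `2^{-n}` and `2^{n+1}` matches `dyadicTerm`. In the minimum `min 1 (t ^
  -- M)`, the low block uses `1` and the high block uses `t ^ M`.
  let Q : ℕ → Space d → ℂ := fun n ξ => b (2 ^ n) ξ + b (2 ^ (n + 1))⁻¹ ξ
  have hQint : ∀ n, Integrable (Q n) := fun n => (hb_int _ (h2 n)).add (hb_int _ (h2' n))
  have hQsum : ∀ n ξ, ∑ k ∈ Finset.range n, Q k ξ =
      ((cutoff d (((2 : ℝ) ^ n)⁻¹ • ξ) - cutoff d ((2 : ℝ) ^ n • ξ) : ℝ) : ℂ) * (p ξ)⁻¹ := by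
    intro n ξ
    rw [← sum_annular, Finset.sum_mul]
    refine Finset.sum_congr rfl fun k _ => ?_
    simp only [Q]
    rw [hb_eq _ (h2 k), hb_eq _ (h2' k), add_mul]
  have hQsint : ∀ n, Integrable fun ξ => ∑ k ∈ Finset.range n, Q k ξ := fun n =>
    integrable_finsetSum _ fun k _ => hQint k
  refine exists_operator_of_kernel_series hd hr hM0 hN1 (by linarith) _
    (fun n => inverseKernel (Q n)) (fun n => continuous_inverseKernel (hQint n)) (D := C * B)
    (by positivity) (fun n z => ?_) fun φ x => ?_
  · have hlow := profile_nonneg (d := d) (N := N) (s := (1 / 2) ^ n) (by positivity) z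
    have hhigh := profile_nonneg (d := d) (N := N) (s := 2 ^ (n + 1)) (by positivity) z
    have e1 : ((2 : ℝ) ^ n)⁻¹ = (1 / 2) ^ n := by rw [one_div, inv_pow]
    have e2 : ((2 : ℝ) ^ (n + 1))⁻¹ ^ M = ((2 : ℝ) ^ (n + 1)) ^ (-M) := by
      rw [Real.inv_rpow (by positivity), Real.rpow_neg (by positivity)]
    have b1 := hb_dec _ (h2 n) z
    have b2 := hb_dec _ (h2' n) z
    rw [e1] at b1
    rw [inv_inv] at b2
    calc ‖inverseKernel (Q n) z‖ ≤ ‖inverseKernel (b (2 ^ n)) z‖ +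
          ‖inverseKernel (b (2 ^ (n + 1))⁻¹) z‖ := by
          rw [inverseKernel_add (hb_int _ (h2 n)) (hb_int _ (h2' n))]
          exact norm_add_le _ _
      _ ≤ C * (B * 1) * profile d N ((1 / 2) ^ n) z +
          C * (B * ((2 : ℝ) ^ (n + 1)) ^ (-M)) * profile d N (2 ^ (n + 1)) z := by
          refine add_le_add (b1.trans ?_) (b2.trans ?_)
          · gcongr
            exact min_le_left _ _
          · rw [← e2]
            gcongr
            exact min_le_right _ _
      _ = _ := by
          rw [dyadicTerm]
          ring
  · have hconv := tendsto_multiplier hd (Q := fun n ξ => ∑ k ∈ Finset.range n, Q k ξ)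
      (q := fun ξ => (p ξ)⁻¹) (fun n => (hQsint n).aestronglyMeasurable) (B := c⁻¹)
      (fun n ξ hξ => ?_) (fun ξ hξ => ?_) φ x
    · refine hconv.congr fun n => ?_
      rw [multiplier_neg_eq_integral (hQsint n)]
      refine integral_congr_ae (Filter.Eventually.of_forall fun y => ?_)
      simp only
      rw [inverseKernel_sum hQint]
    · have hb1 := one_le_bracket ξ
      have h1 : c ≤ ‖p ξ‖ := by
        refine le_trans ?_ (hell ξ hξ)
        exact le_mul_of_one_le_right hc.le (Real.one_le_rpow hb1 hM0.le)
      rw [hQsum, norm_mul, norm_inv, Complex.norm_real]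
      have h3 : ‖cutoff d (((2 : ℝ) ^ n)⁻¹ • ξ) - cutoff d ((2 : ℝ) ^ n • ξ)‖ ≤ 1 := by
        rw [Real.norm_eq_abs, abs_le]
        constructor <;>
          linarith [(cutoff d).nonneg' (((2 : ℝ) ^ n)⁻¹ • ξ), (cutoff d).nonneg' ((2 : ℝ) ^ n • ξ),
            (cutoff d).le_one (x := ((2 : ℝ) ^ n)⁻¹ • ξ), (cutoff d).le_one (x := (2 : ℝ) ^ n • ξ)]
      calc _ ≤ 1 * c⁻¹ := by gcongr
        _ = _ := one_mul _
    · simp only [hQsum]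
      simpa using (tendsto_cutoff_sub hξ).mul_const ((p ξ)⁻¹)
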